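/- Let $(\mathcal R,\mu)$ and $(\mathcal S,\nu)$ be non-atomic $\sigma$-finite measure spaces, and let $1<p_0<q<\infty$, $1<p_1<\infty$, $1\le q_0\le\infty$ and $r=\frac{p_0q}{p_1(q-p_0)}$. For a measurable function $f$ let $f^*(t)=\inf\{\lambda\ge 0:\mu(\{|f|>\lambda\})\le t\}$, $t>0$, be its non-increasing rearrangement. For $1<p<\infty$ and $1\le s<\infty$ put $\|f\|_{L^{p,s}}=\bigl(\int_0^\infty t^{\frac sp-1}f^*(t)^s\,dt\bigr)^{1/s}$, and $\|f\|_{L^{p,\infty}}=\sup_{t>0}t^{1/p}f^*(t)$. Let $X=X(\mathcal R,\mu)$ and $Y=Y(\mathcal S,\nu)$ be rearrangement-invariant Banach function spaces (i.e. given by Banach function norms with the Fatou property, finite on characteristic functions of sets of finite measure, controlling the $L^1$-norm on each set of finite measure, and depending on $f$ only through $f^*$). Their representation spaces $\bar X$ on $(0,\mu(\mathcal R))$ and $\bar Y$ on $(0,\nu(\mathcal S))$, both intervals with Lebesgue measure, are given by $\|h\|_{\bar X}=\|f\|_X$ whenever $f^*=h^*$, and likewise for $\bar Y$. Assume that $X\subset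 (L^{p_0,q_0}+L^{q,1})(\mathcal R,\mu)$. Let $Y^{\langle p_1,q_0\rangle}$ be the space of all $\nu$-measurable $g$ with $$\|g\|_{Y^{\langle p_1,q_0\rangle}}=\Bigl\|t^{-\frac1{p_1}}\Bigl(\int_0^t s^{\frac{q_0}{p_1}-1}g^*(s)^{q_0}\,ds\Bigr)^{\frac1{q_0}}\Bigr\|_{\bar Y}<\infty ,$$ and for nonnegative measurable $f$ on $(0,\mu(\mathcal R))$ put $$R_{q_0}f(t)=t^{-\frac1{p_1}}\Bigl(\int_0^{t^r}s^{\frac{q_0}{p_0}-1}f^*(s)^{q_0}\,ds\Bigr)^{\frac1{q_0}},\qquad Sf(t)=\int_{t^r}^\infty s^{\frac1q-1}f^*(s)\,ds .$$ If $q_0=\infty$, the expressions $\bigl(\int_0^a s^{\frac{q_0}{p}-1}f^*(s)^{q_0}ds\bigr)^{1/q_0}$ are read as $\sup_{0<s\le a}s^{1/p}f^*(s)$. Consider operators $T$ defined on $(L^{p_0,q_0}+L^{q,1})(\mathcal R,\mu)$, with $\nu$-measurable functions as values (functions being identified when equal a.e.), that are bounded $$T\colon L^{p_0,q_0}(\mathcal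 R,\mu)\to L^{p_1,q_0}(\mathcal S,\nu)\quad\text{and}\quad T\colon L^{q,1}(\mathcal R,\mu)\to L^\infty(\mathcal S,\nu). \tag{$*$}$$ Such a $T$ is called quasilinear if there is a constant $k$ with $|T(f+g)|\le k(|Tf|+|Tg|)$ and $|T(cf)|=|c|\,|Tf|$ $\nu$-a.e. for all $f,g$ in its domain and all $c\in\mathbb R$. Then the following statements are equivalent. (i) Every linear operator satisfying $(*)$ is bounded from $X(\mathcal R,\mu)$ to $Y^{\langle p_1,q_0\rangle}(\mathcal S,\nu)$. (ii) Every quasilinear operator satisfying $(*)$ is bounded from $X(\mathcal R,\mu)$ to $Y^{\langle p_1,q_0\rangle}(\mathcal S,\nu)$. (iii) The operators $R_{q_0}$ and $S$ are bounded from $\bar X(0,\mu(\mathcal R))$ to $\bar Y(0,\nu(\mathcal S))$. -/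

import Mathlib

open MeasureTheory Filter Topology
open scoped ENNReal NNReal

noncomputable section

namespace CalderonLorentz

/-- `μ` is non-atomic: every measurable set of positive measure has a measurable subset which is
neither null nor of the same measure. (Mathlib's `NoAtoms` only says that points are null.) -/
def NonAtomic {α : Type*} [MeasurableSpace α] (μ : Measure α) : Prop :=
  ∀ A : Set α, MeasurableSet A → 0 < μ A →
    ∃ B : Set α, B ⊆ A ∧ MeasurableSet B ∧ 0 < μ B ∧ μ B < μ A

/-- The non-increasing rearrangement `f^*(t) = inf {λ ≥ 0 : μ {f > λ} ≤ t}`, used for `t > 0`. -/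
def rearr {α : Type*} [MeasurableSpace α] (μ : Measure α) (f : α → ℝ≥0∞) (t : ℝ) : ℝ≥0∞ :=
  sInf {l : ℝ≥0∞ | μ {x | l < f x} ≤ ENNReal.ofReal t}

/-- Rearrangement-invariant Banach function norms on the nonnegative (extended-valued)
`μ`-measurable functions. -/
structure RINorm {α : Type*} [MeasurableSpace α] (μ : Measure α) where
  /-- The functional; its values at non-measurable functions play no role. -/
  norm : (α → ℝ≥0∞) → ℝ≥0∞
  norm_eq_zero_iff : ∀ f, AEMeasurable f μ → (norm f = 0 ↔ f =ᵐ[μ] 0)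
  norm_smul : ∀ (a : ℝ≥0) (f), AEMeasurable f μ → norm (fun x => a * f x) = a * norm f
  norm_add_le : ∀ f g, AEMeasurable f μ → AEMeasurable g μ →
    norm (fun x => f x + g x) ≤ norm f + norm g
  norm_mono : ∀ f g, AEMeasurable f μ → AEMeasurable g μ → f ≤ᵐ[μ] g → norm f ≤ norm g
  /-- The Fatou property. -/
  norm_tendsto : ∀ (f : ℕ → α → ℝ≥0∞) (g : α → ℝ≥0∞), (∀ n, AEMeasurable (f n) μ) →
    AEMeasurable g μ → (∀ᵐ x ∂μ, Monotone fun n => f n x) →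
    (∀ᵐ x ∂μ, Tendsto (fun n => f n x) atTop (𝓝 (g x))) →
    Tendsto (fun n => norm (f n)) atTop (𝓝 (norm g))
  norm_indicator_lt_top : ∀ E, MeasurableSet E → μ E < ∞ → norm (E.indicator fun _ => 1) < ∞
  lintegral_le : ∀ E, MeasurableSet E → μ E < ∞ →
    ∃ C : ℝ≥0, ∀ f, AEMeasurable f μ → ∫⁻ x in E, f x ∂μ ≤ C * norm f
  norm_eq_of_rearr_eq : ∀ f g, AEMeasurable f μ → AEMeasurable g μ →
    (∀ t : ℝ, 0 < t → rearr μ f t = rearr μ g t) → norm f = norm g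

/-- Lebesgue measure on the interval `(0, μ(α))`. -/
def repMeasure {α : Type*} [MeasurableSpace α] (μ : Measure α) : Measure ℝ :=
  volume.restrict {t : ℝ | 0 < t ∧ ENNReal.ofReal t < μ Set.univ}

/-- The norm of the representation space on `(0, μ(α))`: the norm of `h` is the common value of
`X.norm f` over all `f` on the original space with `f^* = h^*`. By rearrangement invariance the
infimum is over at most one value; over a non-atomic σ-finite space such an `f` always exists. -/
def RINorm.repNorm {α : Type*} [MeasurableSpace α] {μ : Measure α} (X : RINorm μ)
    (h : ℝ → ℝ≥0∞) : ℝ≥0∞ :=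
  ⨅ (f : α → ℝ≥0∞) (_ : AEMeasurable f μ)
    (_ : ∀ t : ℝ, 0 < t → rearr μ f t = rearr (repMeasure μ) h t), X.norm f

/-- `(∫_I (s^(1/p) g(s))^q ds/s)^(1/q)` for `q < ∞`, and `sup_{s ∈ I} s^(1/p) g(s)` for `q = ∞`,
where `I` is a subset of `(0, ∞)`. -/
def lorentzFunctional (p : ℝ) (q : ℝ≥0∞) (I : Set ℝ) (g : ℝ → ℝ≥0∞) : ℝ≥0∞ :=
  if q = ∞ then ⨆ s ∈ I, ENNReal.ofReal (s ^ (1 / p)) * g s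
  else (∫⁻ s in I, ENNReal.ofReal (s ^ (q.toReal / p - 1)) * g s ^ q.toReal) ^ (1 / q.toReal)

/-- The Lorentz functional `‖f‖_{p,q}` for `0 < p < ∞`. -/
def lorentzNorm {α : Type*} [MeasurableSpace α] (μ : Measure α) (p : ℝ) (q : ℝ≥0∞)
    (f : α → ℝ) : ℝ≥0∞ :=
  lorentzFunctional p q (Set.Ioi 0) (rearr μ fun x => ‖f x‖ₑ)

/-- The functional of `Y^⟨p,q⟩`. -/
def RINorm.angleNorm {β : Type*} [MeasurableSpace β] {ν : Measure β} (Y : RINorm ν)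
    (p : ℝ) (q : ℝ≥0∞) (g : β → ℝ) : ℝ≥0∞ :=
  Y.repNorm fun t => ENNReal.ofReal (t ^ (-1 / p)) *
    lorentzFunctional p q (Set.Ioc 0 t) (rearr ν fun x => ‖g x‖ₑ)

/-- The exponent `r = p₀ q / (p₁ (q - p₀))`. -/
def slope (p₀ p₁ q : ℝ) : ℝ := p₀ * q / (p₁ * (q - p₀))

/-- `R_{q₀} f (t) = t^(-1/p₁) (∫_0^{t^r} s^(q₀/p₀ - 1) f^*(s)^{q₀} ds)^(1/q₀)` (a supremum if
`q₀ = ∞`); the rearrangement of `f` is taken with respect to the measure `m` on the half-line. -/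
def calderonR (m : Measure ℝ) (p₀ p₁ q : ℝ) (q₀ : ℝ≥0∞) (f : ℝ → ℝ≥0∞) (t : ℝ) : ℝ≥0∞ :=
  ENNReal.ofReal (t ^ (-1 / p₁)) *
    lorentzFunctional p₀ q₀ (Set.Ioc 0 (t ^ slope p₀ p₁ q)) (rearr m f)

/-- `S f (t) = ∫_{t^r}^∞ s^(1/q - 1) f^*(s) ds`. -/
def calderonS (m : Measure ℝ) (p₀ p₁ q : ℝ) (f : ℝ → ℝ≥0∞) (t : ℝ) : ℝ≥0∞ :=
  ∫⁻ s in Set.Ioi (t ^ slope p₀ p₁ q), ENNReal.ofReal (s ^ (1 / q - 1)) * rearr m f s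

/-- An operator on nonnegative functions is bounded between the representation spaces of `X`
and `Y`. -/
def BoundedRep {α β : Type*} [MeasurableSpace α] [MeasurableSpace β] {μ : Measure α}
    {ν : Measure β} (X : RINorm μ) (Y : RINorm ν) (A : (ℝ → ℝ≥0∞) → ℝ → ℝ≥0∞) : Prop :=
  ∃ C : ℝ≥0, ∀ f : ℝ → ℝ≥0∞, AEMeasurable f (repMeasure μ) → X.repNorm f < ∞ →
    Y.repNorm (A f) ≤ C * X.repNorm f

/-- Membership of (the class of) `f` in `L^{p₀,q₀} + L^{q,1}`. -/
def MemSum {α : Type*} [MeasurableSpace α] (μ : Measure α) (p₀ q : ℝ) (q₀ : ℝ≥0∞)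
    (f : α →ₘ[μ] ℝ) : Prop :=
  ∃ f₀ f₁ : α →ₘ[μ] ℝ, f = f₀ + f₁ ∧ lorentzNorm μ p₀ q₀ f₀ < ∞ ∧ lorentzNorm μ q 1 f₁ < ∞

/-- `T` is linear on the set `D` of functions (in use, `D` is a linear space). -/
def LinearOn {α β : Type*} [MeasurableSpace α] [MeasurableSpace β] {μ : Measure α}
    {ν : Measure β} (D : (α →ₘ[μ] ℝ) → Prop) (T : (α →ₘ[μ] ℝ) → (β →ₘ[ν] ℝ)) : Prop :=
  (∀ f g, D f → D g → T (f + g) = T f + T g) ∧ ∀ (c : ℝ) (f), D f → T (c • f) = c • T f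

/-- `T` is quasilinear on the set `D` of functions: `|T(f+g)| ≤ k (|Tf| + |Tg|)` and
`|T(cf)| = |c| |Tf|` almost everywhere. -/
def QuasilinearOn {α β : Type*} [MeasurableSpace α] [MeasurableSpace β] {μ : Measure α}
    {ν : Measure β} (D : (α →ₘ[μ] ℝ) → Prop) (T : (α →ₘ[μ] ℝ) → (β →ₘ[ν] ℝ)) : Prop :=
  (∃ k : ℝ, ∀ f g, D f → D g → ∀ᵐ y ∂ν, |T (f + g) y| ≤ k * (|T f y| + |T g y|)) ∧
    ∀ (c : ℝ) (f), D f → ∀ᵐ y ∂ν, |T (c • f) y| = |c| * |T f y|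

/-- `T : L^{p₀,q₀} → L^{p₁,q₁}` and `T : L^{q,1} → L^∞` boundedly. -/
def EndpointBounded {α β : Type*} [MeasurableSpace α] [MeasurableSpace β] {μ : Measure α}
    {ν : Measure β} (p₀ p₁ q : ℝ) (q₀ q₁ : ℝ≥0∞) (T : (α →ₘ[μ] ℝ) → (β →ₘ[ν] ℝ)) : Prop :=
  (∃ C : ℝ≥0, ∀ f : α →ₘ[μ] ℝ, lorentzNorm μ p₀ q₀ f < ∞ →
    lorentzNorm ν p₁ q₁ (T f) ≤ C * lorentzNorm μ p₀ q₀ f) ∧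
  ∃ C : ℝ≥0, ∀ f : α →ₘ[μ] ℝ, lorentzNorm μ q 1 f < ∞ →
    eLpNorm (T f) ∞ ν ≤ C * lorentzNorm μ q 1 f

/-- `T` is bounded from `X` to `Y^⟨p,q⟩`. -/
def BoundedToAngle {α β : Type*} [MeasurableSpace α] [MeasurableSpace β] {μ : Measure α}
    {ν : Measure β} (X : RINorm μ) (Y : RINorm ν) (p : ℝ) (q : ℝ≥0∞)
    (T : (α →ₘ[μ] ℝ) → (β →ₘ[ν] ℝ)) : Prop :=
  ∃ C : ℝ≥0, ∀ f : α →ₘ[μ] ℝ, X.norm (fun x => ‖f x‖ₑ) < ∞ →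
    Y.angleNorm p q (T f) ≤ C * X.norm fun x => ‖f x‖ₑ

end CalderonLorentz

end

/-!
A non-atomic `σ`-finite measure space carries a measure preserving map onto its representation
interval, obtained from a maximal chain of sets. Hence every nonincreasing function on the interval
is the rearrangement of a function on the space.

For (iii) ⇒ (ii), truncating `f` at the level `f^*(t^r)` splits it into a part in `L^{p₀,q₀}` and a
part in `L^{q,1}`. By the endpoint bounds for the two parts, the average of `(T f)^*` over
`(0, t)` is at most a constant times `R f^*(t) + S f^*(t)`.

For (i) ⇒ (iii), let `σ` and `τ` be measure preserving maps of the two spaces onto their intervals.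
The linear operator `T g (y) = ∫ (σ x + τ y ^ r)^(1/q - 1) g x dμ(x)` satisfies the endpoint bounds,
the first one by Hardy's inequality. At `g = f^* ∘ σ` its value at `y` is the generalized Stieltjes
transform of `f^*` at `τ y ^ r`. Averaged as in `Y^⟨p₁,q₀⟩`, this dominates `R f^*` and `S f^*` up
to a constant.
-/

namespace CalderonLorentz

section MaximalChains

variable {α : Type*} [MeasurableSpace α] {μ : Measure α}

lemma measure_iUnion_of_directed_ae {ι : Type*} [Countable ι] {C : ι → Set α}
    (hC : Directed (fun s t => s ≤ᵐ[μ] t) C) : μ (⋃ i, C i) = ⨆ i, μ (C i) := by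
  refine le_antisymm ?_ (iSup_le fun i => measure_mono (Set.subset_iUnion C i))
  rcases isEmpty_or_nonempty ι with hι | hι
  · simp
  have hmono : Monotone fun s : Finset ι => ⋃ i ∈ s, C i := fun s t hst =>
    Set.biUnion_subset_biUnion_left hst
  rw [Set.iUnion_eq_iUnion_finset, hmono.directed_le.measure_iUnion]
  refine iSup_le fun s => ?_
  have : IsTrans (Set α) fun s t => s ≤ᵐ[μ] t := ⟨fun _ _ _ => EventuallyLE.trans⟩
  obtain ⟨k, hk⟩ := hC.finset_le s
  refine (measure_mono_ae ?_).trans (le_iSup (fun i => μ (C i)) k)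
  filter_upwards [(ae_ball_iff s.countable_toSet).2 hk] with x hx hxs
  obtain ⟨i, hi, hxi⟩ := Set.mem_iUnion₂.1 hxs
  exact hx i hi hxi

lemma measure_iInter_of_directed_ae {ι : Type*} [Countable ι] {C : ι → Set α}
    (hC : Directed (fun s t => t ≤ᵐ[μ] s) C) (hmeas : ∀ i, NullMeasurableSet (C i) μ)
    (hfin : ∃ i, μ (C i) ≠ ∞) : μ (⋂ i, C i) = ⨅ i, μ (C i) := by
  refine le_antisymm (le_iInf fun i => measure_mono (Set.iInter_subset C i)) ?_
  have hanti : Antitone fun s : Finset ι => ⋂ i ∈ s, C i := fun s t hst =>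
    Set.biInter_subset_biInter_left hst
  have : Nonempty ι := hfin.nonempty
  rw [Set.iInter_eq_iInter_finset, hanti.measure_iInter
    (fun s => .biInter s.countable_toSet fun i _ => hmeas i) (hfin.imp' ({·}) (by simp))]
  refine le_iInf fun s => ?_
  have : IsTrans (Set α) fun s t => t ≤ᵐ[μ] s := ⟨fun _ _ _ hst htu => htu.trans hst⟩
  obtain ⟨k, hk⟩ := hC.finset_le s
  refine (iInf_le (fun i => μ (C i)) k).trans (measure_mono_ae ?_)
  filter_upwards [(ae_ball_iff s.countable_toSet).2 hk] with x hx hxk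
  exact Set.mem_iInter₂.2 fun i hi => hx i hi hxk

/-- Measurable sets of finite measure: the sets forming the chains below. -/
abbrev FinSet (μ : Measure α) : Type _ := {s : Set α // MeasurableSet s ∧ μ s < ∞}

/-- Inclusion up to a null set, the relation with respect to which maximal chains are taken. -/
def FinSet.aeSub (s t : FinSet μ) : Prop := s.1 ≤ᵐ[μ] t.1

variable {M : Set (FinSet μ)}

lemma ae_le_total_of_isChain (hM : IsChain FinSet.aeSub M) {s t : FinSet μ} (hs : s ∈ M)
    (ht : t ∈ M) : s.1 ≤ᵐ[μ] t.1 ∨ t.1 ≤ᵐ[μ] s.1 := by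
  rcases eq_or_ne s t with rfl | hne
  · exact Or.inl (EventuallyLE.refl _ _)
  · exact hM hs ht hne

lemma ae_le_of_isChain_of_measure_le (hM : IsChain FinSet.aeSub M) {s t : FinSet μ} (hs : s ∈ M)
    (ht : t ∈ M) (hst : μ s.1 ≤ μ t.1) : s.1 ≤ᵐ[μ] t.1 := by
  rcases ae_le_total_of_isChain hM hs ht with hle | hge
  · exact hle
  · exact (ae_eq_of_ae_subset_of_measure_ge hge hst t.2.1.nullMeasurableSet s.2.2.ne).symm.le

lemma mem_of_isMaxChain (hM : IsMaxChain FinSet.aeSub M) {s : FinSet μ}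
    (hs : ∀ t ∈ M, s.1 ≤ᵐ[μ] t.1 ∨ t.1 ≤ᵐ[μ] s.1) : s ∈ M := by
  rw [hM.2 (hM.1.insert fun t ht _ => hs t ht) (Set.subset_insert _ _)]
  exact Set.mem_insert _ _

lemma iUnion_mem_of_isMaxChain (hM : IsMaxChain FinSet.aeSub M) {C : ℕ → FinSet μ}
    (hC : ∀ n, C n ∈ M) (hfin : μ (⋃ n, (C n).1) < ∞) :
    (⟨⋃ n, (C n).1, .iUnion fun n => (C n).2.1, hfin⟩ : FinSet μ) ∈ M := by
  refine mem_of_isMaxChain hM fun D hD => or_iff_not_imp_right.2 fun hDC => ?_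
  have hCD : ∀ n, (C n).1 ≤ᵐ[μ] D.1 := fun n =>
    (ae_le_total_of_isChain hM.1 (hC n) hD).resolve_right fun hDn =>
      hDC (hDn.trans (Set.subset_iUnion (fun n => (C n).1) n).eventuallyLE)
  simpa only [Set.iUnion_const] using Filter.EventuallyLE.countable_iUnion hCD

lemma iInter_mem_of_isMaxChain (hM : IsMaxChain FinSet.aeSub M) {C : ℕ → FinSet μ}
    (hC : ∀ n, C n ∈ M) :
    (⟨⋂ n, (C n).1, .iInter fun n => (C n).2.1,
      (measure_mono (Set.iInter_subset _ 0)).trans_lt (C 0).2.2⟩ : FinSet μ) ∈ M := by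
  refine mem_of_isMaxChain hM fun D hD => or_iff_not_imp_left.2 fun hCD => ?_
  have hDC : ∀ n, D.1 ≤ᵐ[μ] (C n).1 := fun n =>
    (ae_le_total_of_isChain hM.1 hD (hC n)).resolve_right fun hnD =>
      hCD ((Set.iInter_subset (fun n => (C n).1) n).eventuallyLE.trans hnD)
  simpa only [Set.iInter_const] using Filter.EventuallyLE.countable_iInter hDC

lemma exists_greatest_measure_le (hM : IsMaxChain FinSet.aeSub M) {c : ℝ≥0∞} (hc : c < ∞) :
    ∃ U ∈ M, μ U.1 ≤ c ∧ ∀ D ∈ M, μ D.1 ≤ c → D.1 ≤ᵐ[μ] U.1 := by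
  let S : Set ℝ≥0∞ := {x | ∃ C ∈ M, μ C.1 = x ∧ x ≤ c}
  have hempty : (⟨∅, .empty, by simp⟩ : FinSet μ) ∈ M :=
    mem_of_isMaxChain hM fun t _ => Or.inl (Set.empty_subset t.1).eventuallyLE
  obtain ⟨u, hu_mono, hu_lim, hu⟩ :=
    exists_seq_tendsto_sSup (S := S) ⟨0, _, hempty, by simp, zero_le⟩ (OrderTop.bddAbove S)
  choose C hCM hCu huc using hu
  have hdir : Directed (fun s t => s ≤ᵐ[μ] t) fun n => (C n).1 := directed_of_isDirected_le
    fun m n hmn => ae_le_of_isChain_of_measure_le hM.1 (hCM m) (hCM n)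
      (by simpa only [hCu] using hu_mono hmn)
  have hUc : μ (⋃ n, (C n).1) ≤ c := by
    rw [measure_iUnion_of_directed_ae hdir]
    exact iSup_le fun n => (hCu n).trans_le (huc n)
  have hUM := iUnion_mem_of_isMaxChain hM hCM (hUc.trans_lt hc)
  refine ⟨_, hUM, hUc, fun D hD hDc => ae_le_of_isChain_of_measure_le hM.1 hD hUM ?_⟩
  refine (le_sSup ⟨D, hD, rfl, hDc⟩ : μ D.1 ≤ sSup S).trans (le_of_tendsto' hu_lim fun n => ?_)
  exact (hCu n).symm.trans_le (measure_mono (Set.subset_iUnion (fun n => (C n).1) n))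

lemma exists_least_le_measure (hM : IsMaxChain FinSet.aeSub M) {c : ℝ≥0∞} {E : FinSet μ}
    (hE : E ∈ M) (hcE : c ≤ μ E.1) :
    ∃ V ∈ M, c ≤ μ V.1 ∧ ∀ D ∈ M, c ≤ μ D.1 → V.1 ≤ᵐ[μ] D.1 := by
  let S : Set ℝ≥0∞ := {x | ∃ C ∈ M, μ C.1 = x ∧ c ≤ x}
  obtain ⟨u, hu_anti, hu_lim, hu⟩ :=
    exists_seq_tendsto_sInf (S := S) ⟨_, E, hE, rfl, hcE⟩ (OrderBot.bddBelow S)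
  choose C hCM hCu huc using hu
  have hdir : Directed (fun s t => t ≤ᵐ[μ] s) fun n => (C n).1 := directed_of_isDirected_le
    fun m n hmn => ae_le_of_isChain_of_measure_le hM.1 (hCM n) (hCM m)
      (by simpa only [hCu] using hu_anti hmn)
  have hcV : c ≤ μ (⋂ n, (C n).1) := by
    rw [measure_iInter_of_directed_ae hdir (fun n => (C n).2.1.nullMeasurableSet)
      ⟨0, (C 0).2.2.ne⟩]
    exact le_iInf fun n => (huc n).trans_eq (hCu n).symm
  have hVM := iInter_mem_of_isMaxChain hM hCM
  refine ⟨_, hVM, hcV, fun D hD hcD => ae_le_of_isChain_of_measure_le hM.1 hVM hD ?_⟩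
  refine le_trans (ge_of_tendsto' hu_lim fun n => ?_) (sInf_le ⟨D, hD, rfl, hcD⟩ : sInf S ≤ μ D.1)
  exact (measure_mono (Set.iInter_subset (fun n => (C n).1) n)).trans_eq (hCu n)

lemma exists_mem_measure_eq (hμ : NonAtomic μ) (hM : IsMaxChain FinSet.aeSub M) {c : ℝ≥0∞}
    {E : FinSet μ} (hE : E ∈ M) (hcE : c ≤ μ E.1) : ∃ C ∈ M, μ C.1 = c := by
  obtain ⟨U, hUM, hUc, hU⟩ := exists_greatest_measure_le hM (hcE.trans_lt E.2.2)
  obtain ⟨V, hVM, hcV, hV⟩ := exists_least_le_measure hM hE hcE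
  by_contra! hno
  have hUc_lt : μ U.1 < c := hUc.lt_of_ne (hno U hUM)
  have hUV : U.1 ≤ᵐ[μ] V.1 := ae_le_of_isChain_of_measure_le hM.1 hUM hVM (hUc.trans hcV)
  obtain ⟨B, hBsub, hBmeas, hBpos, hBlt⟩ := hμ (V.1 \ U.1) (V.2.1.diff U.2.1)
    ((tsub_pos_of_lt (hUc_lt.trans_le hcV)).trans_le le_measure_sdiff)
  have hBfin : μ B < ∞ := (measure_mono (hBsub.trans Set.sdiff_subset)).trans_lt V.2.2
  -- `U ∪ B` lies strictly between the consecutive members `U` and `V` of the chain.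
  let W : FinSet μ := ⟨U.1 ∪ B, U.2.1.union hBmeas, measure_union_lt_top U.2.2 hBfin⟩
  have hUW : U.1 ≤ᵐ[μ] W.1 := Set.subset_union_left.eventuallyLE
  have hWV : W.1 ≤ᵐ[μ] V.1 := by
    filter_upwards [hUV] with x hx hxW
    exact hxW.elim hx fun hxB => (hBsub hxB).1
  have hWM : W ∈ M := mem_of_isMaxChain hM fun D hD => (le_total (μ D.1) c).symm.imp
    (fun hcD => hWV.trans (hV D hD hcD)) (fun hDc => (hU D hD hDc).trans hUW)
  rcases le_total (μ W.1) c with hWc | hcW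
  · refine ((ENNReal.lt_add_right U.2.2.ne hBpos.ne').trans_eq ?_).not_ge
      (measure_mono_ae (hU W hWM hWc))
    exact (measure_union (Set.disjoint_right.2 fun x hx => (hBsub hx).2) hBmeas).symm
  · refine hBlt.not_ge (measure_mono_ae ?_)
    filter_upwards [hV W hWM hcW] with x hx hxVU
    exact (hx hxVU.1).resolve_left hxVU.2

end MaximalChains

section MeasurePreserving

variable {α : Type*} [MeasurableSpace α] {μ : Measure α}

lemma exists_isMaxChain_spanningSets_mem (μ : Measure α) [SigmaFinite μ] :
    ∃ M : Set (FinSet μ), IsMaxChain FinSet.aeSub M ∧ ∀ n, ∃ E ∈ M, E.1 = spanningSets μ n := by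
  let E : ℕ → FinSet μ := fun n =>
    ⟨spanningSets μ n, measurableSet_spanningSets μ n, measure_spanningSets_lt_top μ n⟩
  have hE : IsChain FinSet.aeSub (Set.range E) := by
    rintro _ ⟨m, rfl⟩ _ ⟨n, rfl⟩ _
    exact (le_total m n).imp (fun h => (monotone_spanningSets μ h).eventuallyLE)
      (fun h => (monotone_spanningSets μ h).eventuallyLE)
  obtain ⟨M, hM, hEM⟩ := hE.exists_maxChain
  exact ⟨M, hM, fun n => ⟨E n, hEM ⟨n, rfl⟩, rfl⟩⟩

lemma setOf_iInf_ite_lt {γ ι : Type*} (C : ι → Set γ) [∀ i, DecidablePred (· ∈ C i)]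
    (v : ι → ℝ≥0∞) (t : ℝ≥0∞) :
    {x | (⨅ i, if x ∈ C i then v i else ∞) < t} = ⋃ i : {i // v i < t}, C i := by
  ext x
  simp only [Set.mem_ofPred_eq, iInf_lt_iff, Set.mem_iUnion, Subtype.exists, exists_prop]
  refine exists_congr fun i => ?_
  split_ifs with hx <;> simp [hx]

lemma exists_measurable_of_isChain {M : Set (FinSet μ)} (hM : IsChain FinSet.aeSub M)
    (hvalues : ∀ c < μ Set.univ, ∃ C ∈ M, μ C.1 = c) :
    ∃ φ : α → ℝ≥0∞, Measurable φ ∧ (∀ t, μ {x | φ x < t} = min t (μ Set.univ)) ∧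
      ∀ D ∈ M, D.1 ≤ᵐ[μ] {x | φ x < ∞} := by
  classical
  obtain ⟨s, hs_count, hs_dense⟩ := TopologicalSpace.exists_countable_dense ℝ≥0∞
  let J := {c : ℝ≥0∞ // c ∈ s ∧ c < μ Set.univ}
  have : Countable J := (hs_count.mono fun _ hc => hc.1 : {c | c ∈ s ∧ c < μ Set.univ}.Countable)
  choose C hCM hC using fun c : J => hvalues c c.2.2
  let φ : α → ℝ≥0∞ := fun x => ⨅ c : J, if x ∈ (C c).1 then c.1 else ∞
  have hφ_lt : ∀ t, {x | φ x < t} = ⋃ c : {c : J // c.1 < t}, (C c.1).1 :=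
    setOf_iInf_ite_lt (fun c => (C c).1) Subtype.val
  have hφ_measure : ∀ t, μ {x | φ x < t} = min t (μ Set.univ) := by
    intro t
    have hdir : Directed (fun s t => s ≤ᵐ[μ] t) fun c : {c : J // c.1 < t} => (C c.1).1 :=
      directed_of_isDirected_le fun c d hcd =>
        ae_le_of_isChain_of_measure_le hM (hCM c) (hCM d) (by rw [hC, hC]; exact hcd)
    rw [hφ_lt, measure_iUnion_of_directed_ae hdir]
    simp only [hC]
    refine le_antisymm (iSup_le fun c => le_min c.2.le c.1.2.2.le) (le_of_forall_lt fun l hl => ?_)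
    obtain ⟨c, hcs, hlc, hc⟩ := hs_dense.exists_between hl
    obtain ⟨hct, hcμ⟩ := lt_min_iff.1 hc
    exact hlc.trans_le (le_iSup (fun c : {c : J // c.1 < t} => c.1.1) ⟨⟨c, hcs, hcμ⟩, hct⟩)
  refine ⟨φ, .iInf fun c => .ite (C c).2.1 measurable_const measurable_const, hφ_measure,
    fun D hD => ?_⟩
  by_cases hDC : ∃ c, c.1 < ∞ ∧ μ D.1 ≤ μ (C c).1
  · obtain ⟨c, hc, hDc⟩ := hDC
    rw [hφ_lt]
    exact (ae_le_of_isChain_of_measure_le hM hD (hCM c) hDc).trans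
      (Set.subset_iUnion (fun c : {c : J // c.1 < ∞} => (C c.1).1) ⟨c, hc⟩).eventuallyLE
  · push Not at hDC
    have hφD : {x | φ x < ∞} ≤ᵐ[μ] D.1 := by
      rw [hφ_lt]
      filter_upwards [ae_all_iff.2 fun c : {c : J // c.1 < ∞} =>
        ae_le_of_isChain_of_measure_le hM (hCM c) hD (hDC c c.2).le] with x hx hxφ
      obtain ⟨c, hc⟩ := Set.mem_iUnion.1 hxφ
      exact hx c hc
    refine (ae_eq_of_ae_subset_of_measure_ge hφD ?_ ?_ D.2.2.ne).symm.le
    · rw [hφ_measure, min_eq_right le_top]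
      exact measure_mono (Set.subset_univ _)
    · rw [hφ_lt]
      exact (MeasurableSet.iUnion fun c : {c : J // c.1 < ∞} => (C c.1).2.1).nullMeasurableSet

lemma exists_measurable_measure_lt_eq_min [SigmaFinite μ] (hμ : NonAtomic μ) :
    ∃ φ : α → ℝ≥0∞, Measurable φ ∧ (∀ᵐ x ∂μ, φ x < ∞) ∧
      ∀ t, μ {x | φ x < t} = min t (μ Set.univ) := by
  obtain ⟨M, hM, hspan⟩ := exists_isMaxChain_spanningSets_mem μ
  have hvalues : ∀ c < μ Set.univ, ∃ C ∈ M, μ C.1 = c := by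
    intro c hc
    rw [← iUnion_spanningSets μ, (monotone_spanningSets μ).measure_iUnion, lt_iSup_iff] at hc
    obtain ⟨n, hn⟩ := hc
    obtain ⟨E, hE, hEn⟩ := hspan n
    exact exists_mem_measure_eq hμ hM hE (hEn ▸ hn.le)
  obtain ⟨φ, hφ, hφ_measure, hφ_fin⟩ := exists_measurable_of_isChain hM.1 hvalues
  have hspan_fin : ∀ n, ∀ᵐ x ∂μ, x ∈ spanningSets μ n → φ x < ∞ := by
    intro n
    obtain ⟨E, hE, hEn⟩ := hspan n
    exact hEn ▸ hφ_fin E hE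
  refine ⟨φ, hφ, ?_, hφ_measure⟩
  filter_upwards [ae_all_iff.2 hspan_fin] with x hx
  exact hx _ (mem_spanningSetsIndex μ x)

lemma volume_setOf_pos_ofReal_lt (D : ℝ≥0∞) :
    volume {s : ℝ | 0 < s ∧ ENNReal.ofReal s < D} = D := by
  rcases eq_or_ne D ∞ with rfl | hD
  · simp only [ENNReal.ofReal_lt_top, and_true]
    exact Real.volume_Ioi
  · have : {s : ℝ | 0 < s ∧ ENNReal.ofReal s < D} = Set.Ioo 0 D.toReal := Set.ext fun s =>
      and_congr_right fun hs => ENNReal.ofReal_lt_iff_lt_toReal hs.le hD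
    rw [this, Real.volume_Ioo, sub_zero, ENNReal.ofReal_toReal hD]

lemma repMeasure_Iio (μ : Measure α) (t : ℝ) :
    repMeasure μ (Set.Iio t) = min (ENNReal.ofReal t) (μ Set.univ) := by
  rw [repMeasure, Measure.restrict_apply measurableSet_Iio,
    ← volume_setOf_pos_ofReal_lt (min (ENNReal.ofReal t) (μ Set.univ))]
  congr 1
  ext s
  simp only [Set.mem_inter_iff, Set.mem_Iio, Set.mem_ofPred_eq, lt_min_iff,
    and_left_comm (a := s < t)]
  exact and_congr_right fun hs =>
    and_congr_left' (ENNReal.ofReal_lt_ofReal_iff_of_nonneg hs.le).symm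

theorem exists_measurePreserving_repMeasure [SigmaFinite μ] (hμ : NonAtomic μ) :
    ∃ σ : α → ℝ, MeasurePreserving σ μ (repMeasure μ) := by
  obtain ⟨φ, hφ, hφ_fin, hφ_measure⟩ := exists_measurable_measure_lt_eq_min hμ
  have hσ : Measurable fun x => (φ x).toReal := hφ.ennreal_toReal
  have hmap : ∀ t : ℝ, μ.map (fun x => (φ x).toReal) (Set.Iio t) = repMeasure μ (Set.Iio t) := by
    intro t
    rw [Measure.map_apply hσ measurableSet_Iio, repMeasure_Iio, ← hφ_measure]
    refine measure_congr ?_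
    filter_upwards [hφ_fin] with x hx
    exact propext (ENNReal.lt_ofReal_iff_toReal_lt hx.ne).symm
  refine ⟨_, hσ, Measure.ext_of_generateFrom_of_iUnion (Set.range Set.Iio)
    (fun n : ℕ => Set.Iio (n : ℝ)) ?_ isPiSystem_Iio ?_ (fun n => ⟨_, rfl⟩) ?_ ?_⟩
  · rw [← borel_eq_generateFrom_Iio]
    exact BorelSpace.measurable_eq
  · exact Set.iUnion_eq_univ_iff.2 exists_nat_gt
  · intro n
    rw [hmap, repMeasure_Iio]
    exact (min_le_left _ _).trans_lt ENNReal.ofReal_lt_top |>.ne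
  · rintro _ ⟨t, rfl⟩
    exact hmap t

end MeasurePreserving

section Rearrangement

variable {α β : Type*} [MeasurableSpace α] [MeasurableSpace β] {μ : Measure α} {ν : Measure β}

lemma rearr_le_iff {f : α → ℝ≥0∞} {t : ℝ} {l : ℝ≥0∞} :
    rearr μ f t ≤ l ↔ μ {x | l < f x} ≤ ENNReal.ofReal t := by
  refine ⟨fun h => ?_, fun h => sInf_le h⟩
  rcases eq_or_ne l ∞ with rfl | hl
  · simp
  obtain ⟨u, hu, hul, hlim⟩ := exists_seq_strictAnti_tendsto' (lt_top_iff_ne_top.2 hl)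
  have hiUnion : {x | l < f x} = ⋃ n, {x | u n < f x} := by
    ext x
    simp only [Set.mem_ofPred_eq, Set.mem_iUnion]
    exact ⟨fun hx => ((tendsto_order.1 hlim).2 _ hx).exists, fun ⟨n, hn⟩ => (hul n).1.trans hn⟩
  have hmono : Monotone fun n => {x | u n < f x} := fun m n hmn x hx =>
    (hu.antitone hmn).trans_lt hx
  rw [hiUnion, hmono.measure_iUnion]
  refine iSup_le fun n => ?_
  obtain ⟨l', hl', hlt⟩ := sInf_lt_iff.1 (h.trans_lt (hul n).1)
  exact (measure_mono fun x hx => hlt.trans hx).trans hl'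

lemma lt_rearr_iff {f : α → ℝ≥0∞} {t : ℝ} {l : ℝ≥0∞} :
    l < rearr μ f t ↔ ENNReal.ofReal t < μ {x | l < f x} := by
  rw [← not_le, rearr_le_iff, not_le]

lemma rearr_antitone (μ : Measure α) (f : α → ℝ≥0∞) : Antitone (rearr μ f) := fun _ _ h =>
  rearr_le_iff.2 ((rearr_le_iff.1 le_rfl).trans (ENNReal.ofReal_le_ofReal h))

lemma measurable_rearr (μ : Measure α) (f : α → ℝ≥0∞) : Measurable (rearr μ f) :=
  (rearr_antitone μ f).measurable

lemma rearr_mono {f g : α → ℝ≥0∞} (hfg : f ≤ᵐ[μ] g) (t : ℝ) : rearr μ f t ≤ rearr μ g t := by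
  refine rearr_le_iff.2 ((measure_mono_ae ?_).trans (rearr_le_iff.1 (le_refl (rearr μ g t))))
  filter_upwards [hfg] with x hx hlt using hlt.trans_le hx

lemma rearr_congr {f g : α → ℝ≥0∞} (hfg : f =ᵐ[μ] g) : rearr μ f = rearr μ g :=
  funext fun t => (rearr_mono hfg.le t).antisymm (rearr_mono hfg.ge t)

lemma rearr_congr_distrib {f : α → ℝ≥0∞} {g : β → ℝ≥0∞}
    (h : ∀ l, μ {x | l < f x} = ν {x | l < g x}) : rearr μ f = rearr ν g := by
  ext t
  simp only [rearr, h]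

lemma rearr_comp {m : Measure β} {σ : α → β} (hσ : MeasurePreserving σ μ m) {h : β → ℝ≥0∞}
    (hh : AEMeasurable h m) : rearr μ (fun x => h (σ x)) = rearr m h :=
  rearr_congr_distrib fun _ => hσ.measure_preimage (nullMeasurableSet_lt aemeasurable_const hh)

lemma rearr_eq_zero (f : α → ℝ≥0∞) {t : ℝ} (ht : μ Set.univ ≤ ENNReal.ofReal t) :
    rearr μ f t = 0 :=
  nonpos_iff_eq_zero.1 (rearr_le_iff.2 ((measure_mono (Set.subset_univ _)).trans ht))

lemma rearr_le_mul_add {f g h : α → ℝ≥0∞} {k l : ℝ≥0∞}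
    (hfgh : ∀ᵐ x ∂μ, f x ≤ k * (g x + h x)) (hh : ∀ᵐ x ∂μ, h x ≤ l) (t : ℝ) :
    rearr μ f t ≤ k * (rearr μ g t + l) := by
  refine rearr_le_iff.2 ((measure_mono_ae ?_).trans (rearr_le_iff.1 (le_refl (rearr μ g t))))
  filter_upwards [hfgh, hh] with x hx hxl hlt
  by_contra hle
  refine hlt.not_ge (hx.trans ?_)
  gcongr
  exact not_lt.1 hle

lemma measurableSet_setOf_pos_ofReal_lt (D : ℝ≥0∞) :
    MeasurableSet {s : ℝ | 0 < s ∧ ENNReal.ofReal s < D} :=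
  measurableSet_Ioi.inter (measurableSet_lt ENNReal.measurable_ofReal measurable_const)

lemma repMeasure_univ (μ : Measure α) : repMeasure μ Set.univ = μ Set.univ := by
  rw [repMeasure, Measure.restrict_apply_univ, volume_setOf_pos_ofReal_lt]

lemma repMeasure_repMeasure (μ : Measure α) : repMeasure (repMeasure μ) = repMeasure μ := by
  rw [repMeasure, repMeasure_univ, repMeasure]

lemma ae_pos_of_measurePreserving {σ : α → ℝ}
    (hσ : MeasurePreserving σ μ (repMeasure μ)) :
    ∀ᵐ x ∂μ, 0 < σ x :=
  hσ.quasiMeasurePreserving.ae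
    ((ae_restrict_mem (measurableSet_setOf_pos_ofReal_lt _)).mono fun _ hs => hs.1)

lemma lintegral_repMeasure_of_eq_zero {h : ℝ → ℝ≥0∞}
    (hh : ∀ s, μ Set.univ ≤ ENNReal.ofReal s → h s = 0) :
    ∫⁻ s, h s ∂repMeasure μ = ∫⁻ s in Set.Ioi 0, h s := by
  rw [repMeasure, ← lintegral_indicator (measurableSet_setOf_pos_ofReal_lt _),
    ← lintegral_indicator measurableSet_Ioi]
  refine lintegral_congr fun s => ?_
  by_cases hs : ENNReal.ofReal s < μ Set.univ
  · simp only [Set.indicator_apply, Set.mem_ofPred_eq, Set.mem_Ioi, hs, and_true]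
  · simp only [Set.indicator_apply, hh s (not_lt.1 hs), ite_self]

lemma repMeasure_lt_rearr (f : α → ℝ≥0∞) (l : ℝ≥0∞) :
    repMeasure μ {s | l < rearr μ f s} = μ {x | l < f x} := by
  rw [repMeasure, Measure.restrict_apply (measurableSet_lt measurable_const
    (measurable_rearr μ f)), ← volume_setOf_pos_ofReal_lt (μ {x | l < f x})]
  congr 1
  ext s
  simp only [lt_rearr_iff, Set.mem_inter_iff, Set.mem_ofPred_eq]
  exact ⟨fun h => ⟨h.2.1, h.1⟩,
    fun h => ⟨h.2, h.1, h.2.trans_le (measure_mono (Set.subset_univ _))⟩⟩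

lemma rearr_repMeasure_rearr (f : α → ℝ≥0∞) : rearr (repMeasure μ) (rearr μ f) = rearr μ f :=
  rearr_congr_distrib (repMeasure_lt_rearr f)

lemma rearr_repMeasure_le_of_antitoneOn {h : ℝ → ℝ≥0∞} (hh : AntitoneOn h (Set.Ioi 0)) {s : ℝ}
    (hs : 0 < s) : rearr (repMeasure ν) h s ≤ h s := by
  rw [rearr_le_iff, repMeasure, Measure.restrict_apply' (measurableSet_setOf_pos_ofReal_lt _)]
  calc volume ({x | h s < h x} ∩ {t | 0 < t ∧ ENNReal.ofReal t < ν Set.univ})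
      ≤ volume (Set.Ioo 0 s) := measure_mono fun x hx =>
        ⟨hx.2.1, not_le.1 fun hsx => (hh hs hx.2.1 hsx).not_gt hx.1⟩
    _ = ENNReal.ofReal s := by rw [Real.volume_Ioo, sub_zero]

lemma le_rearr_repMeasure_of_antitoneOn {h : ℝ → ℝ≥0∞} (hh : AntitoneOn h (Set.Ioi 0)) {s s' : ℝ}
    (hs : 0 < s) (hss : s < s') (hs' : ENNReal.ofReal s' < ν Set.univ) :
    h s' ≤ rearr (repMeasure ν) h s := by
  refine le_of_forall_lt fun l hl => ?_
  rw [lt_rearr_iff, repMeasure, Measure.restrict_apply' (measurableSet_setOf_pos_ofReal_lt _)]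
  calc ENNReal.ofReal s < ENNReal.ofReal s' := (ENNReal.ofReal_lt_ofReal_iff (hs.trans hss)).2 hss
    _ = volume (Set.Ioc 0 s') := by rw [Real.volume_Ioc, sub_zero]
    _ ≤ volume ({x | l < h x} ∩ {t | 0 < t ∧ ENNReal.ofReal t < ν Set.univ}) :=
      measure_mono fun x hx => ⟨hl.trans_le (hh hx.1 (hs.trans hss) hx.2), hx.1,
        (ENNReal.ofReal_le_ofReal hx.2).trans_lt hs'⟩

end Rearrangement

section RepNorm

variable {α : Type*} [MeasurableSpace α] {μ : Measure α} (X : RINorm μ)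

lemma RINorm.repNorm_eq_norm_of_rearr_eq {h : ℝ → ℝ≥0∞} {u : α → ℝ≥0∞} (hu : AEMeasurable u μ)
    (hhu : rearr μ u = rearr (repMeasure μ) h) : X.repNorm h = X.norm u := by
  refine le_antisymm (iInf₂_le_of_le u hu (iInf_le _ fun t _ => congrFun hhu t)) ?_
  refine le_iInf₂ fun f hf => le_iInf fun hfh => le_of_eq ?_
  exact X.norm_eq_of_rearr_eq _ _ hu hf fun t ht => by rw [hhu, hfh t ht]

lemma RINorm.repNorm_rearr {u : α → ℝ≥0∞} (hu : AEMeasurable u μ) :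
    X.repNorm (rearr μ u) = X.norm u :=
  X.repNorm_eq_norm_of_rearr_eq hu (rearr_repMeasure_rearr u).symm

variable {σ : α → ℝ} {h k : ℝ → ℝ≥0∞}

lemma RINorm.repNorm_eq_norm_comp (hσ : MeasurePreserving σ μ (repMeasure μ))
    (hh : AEMeasurable h (repMeasure μ)) :
    X.repNorm h = X.norm fun x => h (σ x) :=
  X.repNorm_eq_norm_of_rearr_eq (hh.comp_quasiMeasurePreserving hσ.quasiMeasurePreserving)
    (rearr_comp hσ hh)

lemma RINorm.repNorm_mono (hσ : MeasurePreserving σ μ (repMeasure μ))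
    (hh : AEMeasurable h (repMeasure μ)) (hk : AEMeasurable k (repMeasure μ))
    (hhk : h ≤ᵐ[repMeasure μ] k) : X.repNorm h ≤ X.repNorm k := by
  rw [X.repNorm_eq_norm_comp hσ hh, X.repNorm_eq_norm_comp hσ hk]
  exact X.norm_mono _ _ (hh.comp_quasiMeasurePreserving hσ.quasiMeasurePreserving)
    (hk.comp_quasiMeasurePreserving hσ.quasiMeasurePreserving)
    (hσ.quasiMeasurePreserving.ae hhk)

lemma RINorm.repNorm_const_mul (hσ : MeasurePreserving σ μ (repMeasure μ)) (c : ℝ≥0)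
    (hh : AEMeasurable h (repMeasure μ)) :
    X.repNorm (fun t => c * h t) = c * X.repNorm h := by
  rw [X.repNorm_eq_norm_comp hσ hh, X.repNorm_eq_norm_comp hσ (hh.const_mul _)]
  exact X.norm_smul _ _ (hh.comp_quasiMeasurePreserving hσ.quasiMeasurePreserving)

lemma RINorm.repNorm_add_le (hσ : MeasurePreserving σ μ (repMeasure μ))
    (hh : AEMeasurable h (repMeasure μ)) (hk : AEMeasurable k (repMeasure μ)) :
    X.repNorm (fun t => h t + k t) ≤ X.repNorm h + X.repNorm k := by
  rw [X.repNorm_eq_norm_comp hσ hh, X.repNorm_eq_norm_comp hσ hk,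
    X.repNorm_eq_norm_comp hσ (h := fun t => h t + k t) (hh.add hk)]
  exact X.norm_add_le _ _ (hh.comp_quasiMeasurePreserving hσ.quasiMeasurePreserving)
    (hk.comp_quasiMeasurePreserving hσ.quasiMeasurePreserving)

end RepNorm

section HardyLittlewood

variable {α : Type*} [MeasurableSpace α] {μ : Measure α} [SFinite μ]

lemma lintegral_eq_lintegral_measure_ofReal_lt {u : α → ℝ≥0∞} (hu : Measurable u) :
    ∫⁻ x, u x ∂μ = ∫⁻ k in Set.Ioi (0 : ℝ), μ {x | ENNReal.ofReal k < u x} := by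
  have hS : MeasurableSet {p : α × ℝ | ENNReal.ofReal p.2 < u p.1} := measurableSet_lt
    (ENNReal.measurable_ofReal.comp measurable_snd) (hu.comp measurable_fst)
  have hslice : ∀ c, ∫⁻ k in Set.Ioi (0 : ℝ), {k : ℝ | ENNReal.ofReal k < c}.indicator 1 k = c := by
    intro c
    have hm : MeasurableSet {k : ℝ | ENNReal.ofReal k < c} :=
      measurableSet_lt ENNReal.measurable_ofReal measurable_const
    rw [lintegral_indicator_one hm, Measure.restrict_apply hm, Set.inter_comm]
    exact volume_setOf_pos_ofReal_lt c
  calc ∫⁻ x, u x ∂μ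
      = ∫⁻ x, (∫⁻ k in Set.Ioi (0 : ℝ), {k : ℝ | ENNReal.ofReal k < u x}.indicator 1 k) ∂μ := by
        simp only [hslice]
    _ = ∫⁻ k in Set.Ioi (0 : ℝ), (∫⁻ x, {x | ENNReal.ofReal k < u x}.indicator 1 x ∂μ) :=
        lintegral_lintegral_swap (measurable_one.indicator hS).aemeasurable
    _ = ∫⁻ k in Set.Ioi (0 : ℝ), μ {x | ENNReal.ofReal k < u x} :=
        lintegral_congr fun k => lintegral_indicator_one (measurableSet_lt measurable_const hu)

lemma lintegral_mul_eq_lintegral_lintegral_measure {u v : α → ℝ≥0∞} (hu : Measurable u)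
    (hv : Measurable v) :
    ∫⁻ x, u x * v x ∂μ = ∫⁻ k in Set.Ioi (0 : ℝ), ∫⁻ l in Set.Ioi (0 : ℝ),
      μ ({x | ENNReal.ofReal l < v x} ∩ {x | ENNReal.ofReal k < u x}) := by
  have hu_meas : ∀ k : ℝ, MeasurableSet {x | ENNReal.ofReal k < u x} := fun k =>
    measurableSet_lt measurable_const hu
  calc ∫⁻ x, u x * v x ∂μ = ∫⁻ x, u x ∂μ.withDensity v := by
        simp only [lintegral_withDensity_eq_lintegral_mul _ hv hu, Pi.mul_apply, mul_comm]
    _ = ∫⁻ k in Set.Ioi (0 : ℝ), ∫⁻ x in {x | ENNReal.ofReal k < u x}, v x ∂μ := by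
        simp only [lintegral_eq_lintegral_measure_ofReal_lt hu, withDensity_apply _ (hu_meas _)]
    _ = _ := by
        simp only [lintegral_eq_lintegral_measure_ofReal_lt hv,
          Measure.restrict_apply' (hu_meas _)]

theorem lintegral_mul_le_lintegral_rearr_mul_rearr {u v : α → ℝ≥0∞} (hu : Measurable u)
    (hv : Measurable v) :
    ∫⁻ x, u x * v x ∂μ ≤ ∫⁻ s in Set.Ioi 0, rearr μ u s * rearr μ v s := by
  rw [lintegral_mul_eq_lintegral_lintegral_measure hu hv,
    lintegral_mul_eq_lintegral_lintegral_measure (measurable_rearr μ u) (measurable_rearr μ v)]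
  refine lintegral_mono fun k => lintegral_mono fun l => ?_
  rw [Measure.restrict_apply' measurableSet_Ioi]
  calc μ ({x | ENNReal.ofReal l < v x} ∩ {x | ENNReal.ofReal k < u x})
      ≤ min (μ {x | ENNReal.ofReal l < v x}) (μ {x | ENNReal.ofReal k < u x}) :=
        le_min (measure_mono Set.inter_subset_left) (measure_mono Set.inter_subset_right)
    _ = volume {s : ℝ | 0 < s ∧ ENNReal.ofReal s <
          min (μ {x | ENNReal.ofReal l < v x}) (μ {x | ENNReal.ofReal k < u x})} :=
        (volume_setOf_pos_ofReal_lt _).symm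
    _ ≤ _ := measure_mono fun s ⟨hs, hslt⟩ => by
        rw [lt_min_iff] at hslt
        exact ⟨⟨lt_rearr_iff.2 hslt.1, lt_rearr_iff.2 hslt.2⟩, hs⟩

theorem lintegral_comp_mul_le {σ : α → ℝ} (hσ : MeasurePreserving σ μ (repMeasure μ))
    {φ : ℝ → ℝ≥0∞} (hφ : Measurable φ) (hφ_anti : AntitoneOn φ (Set.Ioi 0)) {v : α → ℝ≥0∞}
    (hv : Measurable v) :
    ∫⁻ x, φ (σ x) * v x ∂μ ≤ ∫⁻ s in Set.Ioi 0, φ s * rearr μ v s := by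
  refine (lintegral_mul_le_lintegral_rearr_mul_rearr (hφ.comp hσ.measurable) hv).trans
    (setLIntegral_mono' measurableSet_Ioi fun s hs => ?_)
  gcongr
  exact (congrFun (rearr_comp hσ hφ.aemeasurable) s).trans_le
    (rearr_repMeasure_le_of_antitoneOn hφ_anti hs)

end HardyLittlewood

section PowerIntegrals

lemma image_mul_rpow_Ioi {v r : ℝ} (hv : 0 < v) (hr : 0 < r) :
    (fun t : ℝ => v * t ^ r) '' Set.Ioi 0 = Set.Ioi 0 := by
  ext u
  refine ⟨?_, fun hu => ?_⟩
  · rintro ⟨t, ht, rfl⟩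
    exact mul_pos hv (Real.rpow_pos_of_pos ht r)
  · have huv : 0 < u / v := div_pos hu hv
    refine ⟨(u / v) ^ (1 / r), Real.rpow_pos_of_pos huv _, ?_⟩
    dsimp only
    rw [← Real.rpow_mul huv.le, one_div_mul_cancel hr.ne', Real.rpow_one, mul_div_cancel₀ _ hv.ne']

lemma lintegral_comp_mul_rpow {v r : ℝ} (hv : 0 < v) (hr : 0 < r) (f : ℝ → ℝ≥0∞) :
    ∫⁻ t in Set.Ioi (0 : ℝ), ENNReal.ofReal (v * (r * t ^ (r - 1))) * f (v * t ^ r) =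
      ∫⁻ u in Set.Ioi (0 : ℝ), f u := by
  have hinj : Set.InjOn (fun t : ℝ => v * t ^ r) (Set.Ioi 0) := fun s hs t ht h =>
    (Real.rpow_left_inj (le_of_lt hs) (le_of_lt ht) hr.ne').1 (mul_left_cancel₀ hv.ne' h)
  have hderiv : ∀ t ∈ Set.Ioi (0 : ℝ), HasDerivWithinAt (fun t : ℝ => v * t ^ r)
      (v * (r * t ^ (r - 1))) (Set.Ioi 0) t := fun t ht =>
    ((Real.hasDerivAt_rpow_const (Or.inl (ne_of_gt ht))).const_mul v).hasDerivWithinAt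
  have hsubst := lintegral_image_eq_lintegral_abs_deriv_mul measurableSet_Ioi hderiv hinj f
  rw [image_mul_rpow_Ioi hv hr] at hsubst
  rw [hsubst]
  refine setLIntegral_congr_fun measurableSet_Ioi fun t ht => ?_
  have ht0 : (0 : ℝ) < t := ht
  rw [abs_of_nonneg (by positivity)]

lemma setLIntegral_Ioc_rpow {a e : ℝ} (ha : 0 < a) (he : 0 < e) :
    ∫⁻ s in Set.Ioc 0 a, ENNReal.ofReal (s ^ (e - 1)) = ENNReal.ofReal (a ^ e / e) := by
  have hint : IntegrableOn (fun s : ℝ => s ^ (e - 1)) (Set.Ioc 0 a) :=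
    (intervalIntegral.intervalIntegrable_rpow' (by linarith)).1
  rw [← ofReal_integral_eq_lintegral_ofReal hint, ← intervalIntegral.integral_of_le ha.le,
    integral_rpow (Or.inl (by linarith)), sub_add_cancel, Real.zero_rpow he.ne', sub_zero]
  exact (ae_restrict_iff' measurableSet_Ioc).2
    (Eventually.of_forall fun s hs => Real.rpow_nonneg hs.1.le _)

lemma ofReal_rpow_mul_ofReal_rpow {x : ℝ} (hx : 0 < x) (a b : ℝ) :
    ENNReal.ofReal (x ^ a) * ENNReal.ofReal (x ^ b) = ENNReal.ofReal (x ^ (a + b)) := by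
  rw [← ENNReal.ofReal_mul (by positivity), ← Real.rpow_add hx]

end PowerIntegrals

section LorentzFunctional

variable {p : ℝ} {q : ℝ≥0∞} {I : Set ℝ} {g h : ℝ → ℝ≥0∞}

lemma lorentzFunctional_top (p : ℝ) (I : Set ℝ) (g : ℝ → ℝ≥0∞) :
    lorentzFunctional p ∞ I g = ⨆ s ∈ I, ENNReal.ofReal (s ^ (1 / p)) * g s := if_pos rfl

lemma lorentzFunctional_of_ne_top (p : ℝ) (hq : q ≠ ∞) (I : Set ℝ) (g : ℝ → ℝ≥0∞) :
    lorentzFunctional p q I g = (∫⁻ s in I, ENNReal.ofReal (s ^ (q.toReal / p - 1)) *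
      g s ^ q.toReal) ^ (1 / q.toReal) := if_neg hq

lemma lorentzFunctional_one (p : ℝ) (I : Set ℝ) (g : ℝ → ℝ≥0∞) :
    lorentzFunctional p 1 I g = ∫⁻ s in I, ENNReal.ofReal (s ^ (1 / p - 1)) * g s := by
  simp [lorentzFunctional_of_ne_top p ENNReal.one_ne_top]

lemma lorentzFunctional_mono (hI : MeasurableSet I) (hgh : ∀ s ∈ I, g s ≤ h s) :
    lorentzFunctional p q I g ≤ lorentzFunctional p q I h := by
  rcases eq_or_ne q ∞ with rfl | hq
  · simp only [lorentzFunctional_top]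
    gcongr with s hs
    exact hgh s hs
  · simp only [lorentzFunctional_of_ne_top p hq]
    gcongr ?_ ^ (1 / q.toReal)
    refine setLIntegral_mono' hI fun s hs => ?_
    gcongr
    exact hgh s hs

lemma lorentzFunctional_congr (hI : MeasurableSet I) (hgh : Set.EqOn g h I) :
    lorentzFunctional p q I g = lorentzFunctional p q I h :=
  le_antisymm (lorentzFunctional_mono hI fun _ hs => (hgh hs).le)
    (lorentzFunctional_mono hI fun _ hs => (hgh hs).ge)

lemma lorentzFunctional_mono_set {J : Set ℝ} (hIJ : I ⊆ J) :
    lorentzFunctional p q I g ≤ lorentzFunctional p q J g := by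
  rcases eq_or_ne q ∞ with rfl | hq
  · simp only [lorentzFunctional_top]
    exact biSup_mono fun _ hs => hIJ hs
  · simp only [lorentzFunctional_of_ne_top p hq]
    gcongr ?_ ^ (1 / q.toReal)
    exact lintegral_mono_set hIJ

lemma lorentzFunctional_indicator (hq₀ : q ≠ 0) {J : Set ℝ} (hJ : MeasurableSet J) :
    lorentzFunctional p q I (J.indicator g) = lorentzFunctional p q (J ∩ I) g := by
  rcases eq_or_ne q ∞ with rfl | hq
  · simp only [lorentzFunctional_top]
    refine le_antisymm (iSup₂_le fun s hs => ?_) (iSup₂_le fun s hs => ?_)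
    · by_cases hsJ : s ∈ J
      · rw [Set.indicator_of_mem hsJ]
        exact le_iSup₂_of_le s ⟨hsJ, hs⟩ le_rfl
      · simp [Set.indicator_of_notMem hsJ]
    · exact le_iSup₂_of_le s hs.2 (by rw [Set.indicator_of_mem hs.1])
  · have hq' := ENNReal.toReal_pos hq₀ hq
    simp only [lorentzFunctional_of_ne_top p hq]
    rw [← setLIntegral_indicator hJ]
    congr 2 with s
    by_cases hsJ : s ∈ J
    · simp only [Set.indicator_of_mem hsJ]
    · simp only [Set.indicator_of_notMem hsJ, ENNReal.zero_rpow_of_pos hq', mul_zero]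

lemma lorentzFunctional_const_mul (hq₀ : q ≠ 0) (I : Set ℝ) (g : ℝ → ℝ≥0∞) {c : ℝ≥0∞}
    (hc : c ≠ ∞) :
    lorentzFunctional p q I (fun s => c * g s) = c * lorentzFunctional p q I g := by
  rcases eq_or_ne q ∞ with rfl | hq
  · simp only [lorentzFunctional_top, ENNReal.mul_iSup, mul_left_comm]
  · have hq' := ENNReal.toReal_pos hq₀ hq
    simp only [lorentzFunctional_of_ne_top p hq, ENNReal.mul_rpow_of_nonneg _ _ hq'.le,
      mul_left_comm _ (c ^ q.toReal)]
    rw [lintegral_const_mul' _ _ (ENNReal.rpow_ne_top_of_nonneg hq'.le hc),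
      ENNReal.mul_rpow_of_nonneg _ _ (by positivity), ← ENNReal.rpow_mul,
      mul_one_div_cancel hq'.ne', ENNReal.rpow_one]

lemma lorentzFunctional_add_le (hq₁ : 1 ≤ q) (I : Set ℝ) (hg : Measurable g) (hh : Measurable h) :
    lorentzFunctional p q I (fun s => g s + h s) ≤
      lorentzFunctional p q I g + lorentzFunctional p q I h := by
  rcases eq_or_ne q ∞ with rfl | hq
  · simp only [lorentzFunctional_top, mul_add]
    exact iSup₂_le fun s hs => add_le_add (le_iSup₂_of_le s hs le_rfl) (le_iSup₂_of_le s hs le_rfl)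
  · have hq' : 1 ≤ q.toReal := by simpa using ENNReal.toReal_mono hq hq₁
    have hweight (f : ℝ → ℝ≥0∞) (hf : Measurable f) : lorentzFunctional p q I f =
        (∫⁻ s, f s ^ q.toReal ∂(volume.restrict I).withDensity fun s =>
          ENNReal.ofReal (s ^ (q.toReal / p - 1))) ^ (1 / q.toReal) := by
      rw [lorentzFunctional_of_ne_top p hq,
        lintegral_withDensity_eq_lintegral_mul _ (by fun_prop) (hf.pow_const _)]
      rfl
    rw [hweight (fun s => g s + h s) (hg.add hh), hweight _ hg, hweight _ hh]
    exact ENNReal.lintegral_Lp_add_le hg.aemeasurable hh.aemeasurable hq'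

lemma lorentzFunctional_rpow_mul {p' e : ℝ} (hq₀ : q ≠ 0) (hI : MeasurableSet I)
    (hI₀ : I ⊆ Set.Ioi 0) (he : 1 / p = 1 / p' + e) (g : ℝ → ℝ≥0∞) :
    lorentzFunctional p' q I (fun s => ENNReal.ofReal (s ^ e) * g s) =
      lorentzFunctional p q I g := by
  rcases eq_or_ne q ∞ with rfl | hq
  · simp only [lorentzFunctional_top]
    refine biSup_congr fun s hs => ?_
    rw [← mul_assoc, ofReal_rpow_mul_ofReal_rpow (hI₀ hs), he]
  · have hq' := ENNReal.toReal_pos hq₀ hq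
    simp only [lorentzFunctional_of_ne_top _ hq]
    congr 1
    refine setLIntegral_congr_fun hI fun s hs => ?_
    have hs0 : 0 < s := hI₀ hs
    rw [ENNReal.mul_rpow_of_nonneg _ _ hq'.le,
      ENNReal.ofReal_rpow_of_nonneg (by positivity) hq'.le, ← Real.rpow_mul hs0.le, ← mul_assoc,
      ofReal_rpow_mul_ofReal_rpow hs0]
    congr 3
    linear_combination -q.toReal * he

/-- For `q = ∞` the factor `r ^ (1 / q.toReal)` is `r ^ (1 / 0) = 1`, as it should be. -/
lemma lorentzFunctional_comp_mul_rpow (hq₀ : q ≠ 0) {v r : ℝ} (hv : 0 < v) (hr : 0 < r)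
    (g : ℝ → ℝ≥0∞) :
    ENNReal.ofReal (v ^ (1 / p) * r ^ (1 / q.toReal)) *
        lorentzFunctional (p / r) q (Set.Ioi 0) (fun t => g (v * t ^ r)) =
      lorentzFunctional p q (Set.Ioi 0) g := by
  rcases eq_or_ne q ∞ with rfl | hq
  · simp only [lorentzFunctional_top, ENNReal.toReal_top, div_zero, Real.rpow_zero, mul_one,
      ENNReal.mul_iSup]
    conv_rhs => rw [← image_mul_rpow_Ioi hv hr]
    rw [iSup_image]
    refine biSup_congr fun t ht => ?_
    have ht0 : (0 : ℝ) < t := ht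
    rw [← mul_assoc, ← ENNReal.ofReal_mul (by positivity), one_div_div,
      Real.mul_rpow hv.le (by positivity), ← Real.rpow_mul ht0.le, mul_one_div]
  · have hq' := ENNReal.toReal_pos hq₀ hq
    simp only [lorentzFunctional_of_ne_top _ hq]
    set b := q.toReal
    have hconst : ENNReal.ofReal (v ^ (1 / p) * r ^ (1 / b)) =
        ENNReal.ofReal (v ^ (b / p) * r) ^ (1 / b) := by
      rw [ENNReal.ofReal_rpow_of_nonneg (by positivity) (by positivity),
        Real.mul_rpow (by positivity) hr.le, ← Real.rpow_mul hv.le]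
      congr 3
      field_simp
    rw [hconst, ← ENNReal.mul_rpow_of_nonneg _ _ (by positivity),
      ← lintegral_const_mul' _ _ ENNReal.ofReal_ne_top,
      ← lintegral_comp_mul_rpow hv hr fun s => ENNReal.ofReal (s ^ (b / p - 1)) * g s ^ b]
    congr 1
    refine setLIntegral_congr_fun measurableSet_Ioi fun t ht => ?_
    have ht0 : (0 : ℝ) < t := ht
    rw [← mul_assoc, ← mul_assoc, ← ENNReal.ofReal_mul (by positivity),
      ← ENNReal.ofReal_mul (by positivity), Real.mul_rpow hv.le (by positivity),
      ← Real.rpow_mul ht0.le]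
    have hv_pow : v * v ^ (b / p - 1) = v ^ (b / p) := by
      rw [Real.rpow_sub_one hv.ne', mul_div_cancel₀ _ hv.ne']
    have ht_pow : t ^ (r - 1) * t ^ (r * (b / p - 1)) = t ^ (b / (p / r) - 1) := by
      rw [← Real.rpow_add ht0, div_div_eq_mul_div]
      ring_nf
    rw [← hv_pow, ← ht_pow]
    ring_nf

lemma lorentzFunctional_Ioc_comp_rpow (hq₀ : q ≠ 0) {r t : ℝ} (hr : 0 < r) (ht : 0 < t)
    (g : ℝ → ℝ≥0∞) :
    ENNReal.ofReal (r ^ (1 / q.toReal)) *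
        lorentzFunctional (p / r) q (Set.Ioc 0 t) (fun u => g (u ^ r)) =
      lorentzFunctional p q (Set.Ioc 0 (t ^ r)) g := by
  have hset (a : ℝ) : Set.Ioc 0 a = Set.Iic a ∩ Set.Ioi 0 := by
    rw [Set.inter_comm, Set.Ioi_inter_Iic]
  rw [hset, hset, ← lorentzFunctional_indicator hq₀ measurableSet_Iic,
    ← lorentzFunctional_indicator hq₀ measurableSet_Iic,
    ← lorentzFunctional_comp_mul_rpow hq₀ one_pos hr ((Set.Iic (t ^ r)).indicator g),
    Real.one_rpow, one_mul]
  congr 1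
  refine lorentzFunctional_congr measurableSet_Ioi fun u hu => ?_
  simp only [one_mul, Set.indicator_apply, Set.mem_Iic,
    Real.rpow_le_rpow_iff (le_of_lt hu) ht.le hr]

end LorentzFunctional

section LorentzAverage

/-- The average `t^(-1/p) (∫_0^t s^(q/p - 1) g(s)^q ds)^(1/q)` (a supremum if `q = ∞`), whose norm
in the representation space defines `Y^⟨p,q⟩`. -/
noncomputable def lorentzAverage (p : ℝ) (q : ℝ≥0∞) (g : ℝ → ℝ≥0∞) (t : ℝ) : ℝ≥0∞ :=
  ENNReal.ofReal (t ^ (-1 / p)) * lorentzFunctional p q (Set.Ioc 0 t) g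

/-- The average of the constant function `1`. For `q = ∞` the formula reads `0 ^ 0 = 1`. -/
noncomputable def lorentzConst (p : ℝ) (q : ℝ≥0∞) : ℝ≥0 :=
  ((p / q.toReal) ^ (1 / q.toReal)).toNNReal

variable {p : ℝ} {q : ℝ≥0∞} {g h : ℝ → ℝ≥0∞} {t : ℝ}

lemma lorentzConst_ne_zero (hp : 0 < p) (hq₀ : q ≠ 0) : lorentzConst p q ≠ 0 := by
  refine (Real.toNNReal_pos.2 ?_).ne'
  rcases eq_or_ne q ∞ with rfl | hq
  · simp
  · have := ENNReal.toReal_pos hq₀ hq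
    positivity

lemma lorentzAverage_const (hp : 0 < p) (hq₀ : q ≠ 0) (ht : 0 < t) (c : ℝ≥0∞) :
    lorentzAverage p q (fun _ => c) t = lorentzConst p q * c := by
  have hcancel : ENNReal.ofReal (t ^ (-1 / p)) * ENNReal.ofReal (t ^ (1 / p)) = 1 := by
    rw [ofReal_rpow_mul_ofReal_rpow ht, ← add_div, neg_add_cancel, zero_div, Real.rpow_zero,
      ENNReal.ofReal_one]
  suffices lorentzFunctional p q (Set.Ioc 0 t) (fun _ => c) =
      ENNReal.ofReal (t ^ (1 / p)) * (lorentzConst p q * c) by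
    rw [lorentzAverage, this, ← mul_assoc, hcancel, one_mul]
  rcases eq_or_ne q ∞ with rfl | hq
  · simp only [lorentzFunctional_top, lorentzConst, ENNReal.toReal_top, div_zero, Real.rpow_zero,
      Real.toNNReal_one, ENNReal.coe_one, one_mul]
    refine le_antisymm (iSup₂_le fun s hs => ?_) (le_iSup₂_of_le t ⟨ht, le_rfl⟩ le_rfl)
    gcongr
    exacts [hs.1.le, hs.2]
  · have hq' := ENNReal.toReal_pos hq₀ hq
    rw [lorentzFunctional_of_ne_top p hq, lorentzConst]
    set b := q.toReal
    rw [lintegral_mul_const _ (by fun_prop), setLIntegral_Ioc_rpow ht (by positivity),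
      ENNReal.mul_rpow_of_nonneg _ _ (by positivity), ← ENNReal.rpow_mul,
      mul_one_div_cancel hq'.ne', ENNReal.rpow_one,
      ENNReal.ofReal_rpow_of_nonneg (by positivity) (by positivity), ← mul_assoc,
      ENNReal.ofNNReal_toNNReal, ← ENNReal.ofReal_mul (by positivity)]
    congr 2
    rw [div_eq_mul_inv, Real.mul_rpow (by positivity) (by positivity), inv_div,
      ← Real.rpow_mul ht.le]
    congr 2
    field_simp

lemma lorentzAverage_mono (hgh : ∀ s ∈ Set.Ioc 0 t, g s ≤ h s) :
    lorentzAverage p q g t ≤ lorentzAverage p q h t :=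
  mul_le_mul_right (lorentzFunctional_mono measurableSet_Ioc hgh) _

lemma lorentzConst_mul_le_lorentzAverage (hp : 0 < p) (hq₀ : q ≠ 0) (ht : 0 < t) {c : ℝ≥0∞}
    (hc : ∀ s ∈ Set.Ioc 0 t, c ≤ g s) : lorentzConst p q * c ≤ lorentzAverage p q g t := by
  rw [← lorentzAverage_const hp hq₀ ht]
  exact lorentzAverage_mono hc

lemma lorentzAverage_const_mul (hq₀ : q ≠ 0) {c : ℝ≥0∞} (hc : c ≠ ∞) :
    lorentzAverage p q (fun s => c * g s) t = c * lorentzAverage p q g t := by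
  rw [lorentzAverage, lorentzFunctional_const_mul hq₀ _ _ hc, mul_left_comm, lorentzAverage]

lemma lorentzAverage_add_const_le (hp : 0 < p) (hq₁ : 1 ≤ q) (hg : Measurable g) (ht : 0 < t)
    (c : ℝ≥0∞) :
    lorentzAverage p q (fun s => g s + c) t ≤ lorentzAverage p q g t + lorentzConst p q * c := by
  rw [← lorentzAverage_const hp (zero_lt_one.trans_le hq₁).ne' ht]
  simp only [lorentzAverage]
  rw [← mul_add]
  gcongr
  exact lorentzFunctional_add_le hq₁ _ hg measurable_const

lemma aemeasurable_rpow_mul_lorentzFunctional_Ioc {β : Type*} [MeasurableSpace β] (ν : Measure β)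
    (e : ℝ) {r : ℝ} (hr : 0 ≤ r) (p : ℝ) (q : ℝ≥0∞) (g : ℝ → ℝ≥0∞) :
    AEMeasurable (fun t => ENNReal.ofReal (t ^ e) * lorentzFunctional p q (Set.Ioc 0 (t ^ r)) g)
      (repMeasure ν) := by
  refine AEMeasurable.mul (by fun_prop) (aemeasurable_restrict_of_monotoneOn
    (measurableSet_setOf_pos_ofReal_lt _) fun s hs t _ hst => ?_)
  exact lorentzFunctional_mono_set
    (Set.Ioc_subset_Ioc_right (Real.rpow_le_rpow (le_of_lt hs.1) hst hr))

lemma aemeasurable_lorentzAverage {β : Type*} [MeasurableSpace β] (ν : Measure β) (p : ℝ)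
    (q : ℝ≥0∞) (g : ℝ → ℝ≥0∞) : AEMeasurable (lorentzAverage p q g) (repMeasure ν) := by
  have := aemeasurable_rpow_mul_lorentzFunctional_Ioc ν (-1 / p) zero_le_one p q g
  simp only [Real.rpow_one] at this
  exact this

end LorentzAverage

section Averaging

lemma lintegral_mul_rpow_le {γ : Type*} [MeasurableSpace γ] {m : Measure γ} {b : ℝ} (hb : 1 ≤ b)
    {w G : γ → ℝ≥0∞} (hw : Measurable w) (hG : Measurable G) :
    (∫⁻ x, w x * G x ∂m) ^ b ≤ (∫⁻ x, w x ∂m) ^ (b - 1) * ∫⁻ x, w x * G x ^ b ∂m := by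
  have hb0 : 0 < b := by linarith
  have hjensen := eLpNorm'_le_eLpNorm'_mul_rpow_measure_univ (μ := m.withDensity w) (p := 1)
    (q := b) one_pos hb hG.aestronglyMeasurable
  simp only [eLpNorm', enorm_eq_self, ENNReal.rpow_one, div_one] at hjensen
  rw [lintegral_withDensity_eq_lintegral_mul _ hw hG,
    lintegral_withDensity_eq_lintegral_mul _ hw (hG.pow_const b),
    withDensity_apply _ MeasurableSet.univ, Measure.restrict_univ] at hjensen
  refine (ENNReal.rpow_le_rpow hjensen hb0.le).trans_eq ?_
  rw [ENNReal.mul_rpow_of_nonneg _ _ hb0.le, ← ENNReal.rpow_mul, ← ENNReal.rpow_mul,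
    one_div_mul_cancel hb0.ne', ENNReal.rpow_one, mul_comm, sub_mul, one_mul,
    one_div_mul_cancel hb0.ne']
  rfl

variable {γ : Type*} [MeasurableSpace γ] {m : Measure γ} {p : ℝ} {q : ℝ≥0∞} {I : Set ℝ}
  {w : γ → ℝ≥0∞} {G : γ → ℝ → ℝ≥0∞} {N : ℝ≥0∞}

lemma setLIntegral_rpow_lintegral_mul_le [SFinite m] {b : ℝ} (hb : 1 ≤ b) {φ : ℝ → ℝ≥0∞}
    (hφ : Measurable φ) (hw : Measurable w) (hG : Measurable (Function.uncurry G))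
    (hN : ∀ᵐ v ∂m, ∫⁻ s in I, φ s * G v s ^ b ≤ N) :
    ∫⁻ s in I, φ s * (∫⁻ v, w v * G v s ∂m) ^ b ≤ (∫⁻ v, w v ∂m) ^ b * N := by
  set K := ∫⁻ v, w v ∂m
  have hG_left (v : γ) : Measurable (G v) := hG.of_uncurry_left
  have hG_right (s : ℝ) : Measurable fun v => G v s := hG.of_uncurry_right
  have hmeas : Measurable (Function.uncurry fun s v => w v * (φ s * G v s ^ b)) :=
    (hw.comp measurable_snd).mul
      ((hφ.comp measurable_fst).mul ((hG.comp measurable_swap).pow_const b))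
  calc ∫⁻ s in I, φ s * (∫⁻ v, w v * G v s ∂m) ^ b
      ≤ ∫⁻ s in I, K ^ (b - 1) * ∫⁻ v, w v * (φ s * G v s ^ b) ∂m := by
        refine lintegral_mono fun s => ?_
        have hwG : Measurable fun v => w v * G v s ^ b := hw.mul ((hG_right s).pow_const b)
        simp only [mul_left_comm _ (φ s)]
        rw [lintegral_const_mul _ hwG, mul_left_comm]
        gcongr
        exact lintegral_mul_rpow_le hb hw (hG_right s)
    _ = K ^ (b - 1) * ∫⁻ v, w v * (∫⁻ s in I, φ s * G v s ^ b) ∂m := by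
        rw [lintegral_const_mul _ (Measurable.lintegral_prod_right hmeas),
          lintegral_lintegral_swap hmeas.aemeasurable]
        congr 1
        exact lintegral_congr fun v => lintegral_const_mul _ (hφ.mul ((hG_left v).pow_const b))
    _ ≤ K ^ (b - 1) * ∫⁻ v, w v * N ∂m := by
        gcongr K ^ (b - 1) * ?_
        exact lintegral_mono_ae (hN.mono fun v hv => by gcongr)
    _ = K ^ b * N := by
        rw [lintegral_mul_const _ hw, ← mul_assoc]
        congr 1
        conv_rhs => rw [← sub_add_cancel b 1]
        rw [ENNReal.rpow_add_of_nonneg _ _ (by linarith) zero_le_one, ENNReal.rpow_one]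

lemma lorentzFunctional_lintegral_mul_le [SFinite m] (hq₁ : 1 ≤ q) (hw : Measurable w)
    (hG : Measurable (Function.uncurry G)) (hN : ∀ᵐ v ∂m, lorentzFunctional p q I (G v) ≤ N) :
    lorentzFunctional p q I (fun s => ∫⁻ v, w v * G v s ∂m) ≤ (∫⁻ v, w v ∂m) * N := by
  rcases eq_or_ne q ∞ with rfl | hq
  · simp only [lorentzFunctional_top] at hN ⊢
    refine iSup₂_le fun s hs => ?_
    rw [← lintegral_const_mul' _ _ ENNReal.ofReal_ne_top, ← lintegral_mul_const _ hw]
    refine lintegral_mono_ae (hN.mono fun v hv => ?_)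
    rw [mul_left_comm]
    gcongr
    exact (le_iSup₂_of_le s hs le_rfl).trans hv
  · have hb : 1 ≤ q.toReal := by simpa using ENNReal.toReal_mono hq hq₁
    have hb0 : 0 < q.toReal := by linarith
    simp only [lorentzFunctional_of_ne_top p hq, one_div,
      ENNReal.rpow_inv_le_iff hb0] at hN ⊢
    rw [ENNReal.mul_rpow_of_nonneg _ _ hb0.le]
    exact setLIntegral_rpow_lintegral_mul_le hb (by fun_prop) hw hG hN

end Averaging

section Stieltjes

/-- The generalized Stieltjes transform `∫_0^∞ (s + a)^(1/q - 1) g(s) ds`. At `a = t^r` it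
dominates both Calderón operators, and it is bounded at both endpoints. -/
noncomputable def stieltjes (q : ℝ) (g : ℝ → ℝ≥0∞) (a : ℝ) : ℝ≥0∞ :=
  ∫⁻ s in Set.Ioi (0 : ℝ), ENNReal.ofReal ((s + a) ^ (1 / q - 1)) * g s

/-- The operator norm `∫_0^∞ v^(-1/p) (1 + v)^(1/q - 1) dv` of the dilation-invariant form
`g ↦ ∫_0^∞ (1 + v)^(1/q - 1) g(v ·) dv` of the Stieltjes transform, relative to the exponent `p`. -/
noncomputable def stieltjesConst (p q : ℝ) : ℝ≥0∞ :=
  ∫⁻ v in Set.Ioi (0 : ℝ), ENNReal.ofReal (v ^ (-(1 / p)) * (1 + v) ^ (1 / q - 1))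

variable {p q : ℝ} {g : ℝ → ℝ≥0∞}

lemma stieltjesConst_lt_top (hp : 1 < p) (hpq : p < q) : stieltjesConst p q < ∞ := by
  have hp' : 1 / p < 1 := (div_lt_one (by linarith)).2 hp
  have hqp : 1 / q < 1 / p := one_div_lt_one_div_of_lt (by linarith) hpq
  rw [stieltjesConst, ← Set.Ioc_union_Ioi_eq_Ioi (zero_le_one' ℝ)]
  refine (lintegral_union_le _ _ _).trans_lt (ENNReal.add_lt_top.2 ⟨?_, ?_⟩)
  · have hint : IntegrableOn (fun v : ℝ => v ^ (-(1 / p))) (Set.Ioc 0 1) :=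
      (intervalIntegral.intervalIntegrable_rpow' (by linarith)).1
    refine (setLIntegral_mono' measurableSet_Ioc fun v hv => ENNReal.ofReal_le_ofReal ?_).trans_lt
      hint.lintegral_lt_top
    exact mul_le_of_le_one_right (Real.rpow_nonneg hv.1.le _)
      (Real.rpow_le_one_of_one_le_of_nonpos (by linarith [hv.1]) (by linarith))
  · have hint : IntegrableOn (fun v : ℝ => v ^ (-(1 / p) + (1 / q - 1))) (Set.Ioi 1) :=
      integrableOn_Ioi_rpow_of_lt (by linarith) one_pos
    refine (setLIntegral_mono' measurableSet_Ioi fun v hv => ENNReal.ofReal_le_ofReal ?_).trans_lt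
      hint.lintegral_lt_top
    have hv0 : (0 : ℝ) < v := one_pos.trans hv
    rw [Real.rpow_add hv0]
    exact mul_le_mul_of_nonneg_left
      (Real.rpow_le_rpow_of_nonpos hv0 (by linarith) (by linarith)) (Real.rpow_nonneg hv0.le _)

lemma one_div_sub_one_nonpos (hq : 1 ≤ q) : 1 / q - 1 ≤ 0 :=
  sub_nonpos.2 ((div_le_one (by linarith)).2 hq)

lemma stieltjes_antitoneOn (hq : 1 ≤ q) (g : ℝ → ℝ≥0∞) :
    AntitoneOn (stieltjes q g) (Set.Ici 0) := by
  intro a ha b _ hab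
  refine setLIntegral_mono' measurableSet_Ioi fun s hs => ?_
  gcongr ENNReal.ofReal ?_ * _
  exact Real.rpow_le_rpow_of_nonpos (add_pos_of_pos_of_nonneg hs ha) (by linarith)
    (one_div_sub_one_nonpos hq)

lemma stieltjes_eq_rpow_mul (p : ℝ) (g : ℝ → ℝ≥0∞) {a : ℝ} (ha : 0 < a) :
    stieltjes q g a = ENNReal.ofReal (a ^ (1 / q)) * ∫⁻ v in Set.Ioi (0 : ℝ),
      ENNReal.ofReal (v ^ (-(1 / p)) * (1 + v) ^ (1 / q - 1)) *
        (ENNReal.ofReal (v ^ (1 / p)) * g (a * v)) := by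
  rw [stieltjes, ← lintegral_comp_mul_rpow ha one_pos,
    ← lintegral_const_mul' _ _ ENNReal.ofReal_ne_top]
  refine setLIntegral_congr_fun measurableSet_Ioi fun v hv => ?_
  have hv0 : (0 : ℝ) < v := hv
  simp only [Real.rpow_one, sub_self, Real.rpow_zero, mul_one]
  rw [← mul_assoc, ← mul_assoc, ← mul_assoc, ← ENNReal.ofReal_mul ha.le,
    ← ENNReal.ofReal_mul (by positivity), ← ENNReal.ofReal_mul (by positivity)]
  congr 2
  have hv_cancel : v ^ (-(1 / p)) * v ^ (1 / p) = 1 := by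
    rw [← Real.rpow_add hv0, neg_add_cancel, Real.rpow_zero]
  have ha_pow : a * a ^ (1 / q - 1) = a ^ (1 / q) := by
    rw [Real.rpow_sub_one ha.ne', mul_div_cancel₀ _ ha.ne']
  rw [show a * v + a = a * (1 + v) by ring, Real.mul_rpow ha.le (by positivity), ← ha_pow]
  linear_combination (-(a * a ^ (1 / q - 1) * (1 + v) ^ (1 / q - 1))) * hv_cancel

/-- Hardy's inequality for the Stieltjes transform, the first endpoint estimate. The substitution
`a = t ^ r` and the factor `a ^ (1 / q)` of homogeneity turn the exponent `p₁` into `p₀`. -/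
lemma lorentzFunctional_stieltjes_le {p₀ p₁ r : ℝ} {q₀ : ℝ≥0∞} (hr : 0 < r)
    (hrel : r / p₀ = 1 / p₁ + r / q) (hq₁ : 1 ≤ q₀) (hg : Measurable g) :
    ENNReal.ofReal (r ^ (1 / q₀.toReal)) *
        lorentzFunctional p₁ q₀ (Set.Ioi 0) (fun t => stieltjes q g (t ^ r)) ≤
      stieltjesConst p₀ q * lorentzFunctional p₀ q₀ (Set.Ioi 0) g := by
  have hq₀ : q₀ ≠ 0 := (zero_lt_one.trans_le hq₁).ne'
  have hsubst := lorentzFunctional_comp_mul_rpow (p := p₁ * r) hq₀ one_pos hr (stieltjes q g)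
  have hrel' : 1 / p₀ = 1 / (p₁ * r) + 1 / q := by
    simp only [div_eq_mul_inv, mul_inv] at hrel ⊢
    linear_combination r⁻¹ * hrel - (p₀⁻¹ - q⁻¹) * inv_mul_cancel₀ hr.ne'
  simp only [Real.one_rpow, one_mul, mul_div_cancel_right₀ _ hr.ne'] at hsubst
  rw [hsubst, lorentzFunctional_congr measurableSet_Ioi
      fun a (ha : 0 < a) => stieltjes_eq_rpow_mul p₀ g ha,
    lorentzFunctional_rpow_mul hq₀ measurableSet_Ioi le_rfl hrel']
  refine lorentzFunctional_lintegral_mul_le hq₁ (by fun_prop) ?_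
    (ae_restrict_of_forall_mem measurableSet_Ioi fun v (hv : 0 < v) => ?_)
  · unfold Function.uncurry
    fun_prop
  · have hdil := lorentzFunctional_comp_mul_rpow (p := p₀) hq₀ hv one_pos g
    simp only [Real.one_rpow, mul_one, div_one, Real.rpow_one, mul_comm v] at hdil
    rw [lorentzFunctional_const_mul hq₀ _ _ ENNReal.ofReal_ne_top, hdil]

lemma exists_lorentzFunctional_stieltjes_le {p₀ p₁ r : ℝ} {q₀ : ℝ≥0∞} (hp₀ : 1 < p₀)
    (hq : p₀ < q) (hr : 0 < r) (hrel : r / p₀ = 1 / p₁ + r / q) (hq₁ : 1 ≤ q₀) :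
    ∃ C : ℝ≥0, ∀ g : ℝ → ℝ≥0∞, Measurable g →
      lorentzFunctional p₁ q₀ (Set.Ioi 0) (fun t => stieltjes q g (t ^ r)) ≤
        C * lorentzFunctional p₀ q₀ (Set.Ioi 0) g := by
  have hc : ENNReal.ofReal (r ^ (1 / q₀.toReal)) ≠ 0 := (ENNReal.ofReal_pos.2 (by positivity)).ne'
  refine ⟨(stieltjesConst p₀ q / ENNReal.ofReal (r ^ (1 / q₀.toReal))).toNNReal, fun g hg => ?_⟩
  rw [ENNReal.coe_toNNReal (ENNReal.div_ne_top (stieltjesConst_lt_top hp₀ hq).ne hc),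
    div_eq_mul_inv, mul_right_comm, ← div_eq_mul_inv,
    ENNReal.le_div_iff_mul_le (Or.inl hc) (Or.inl ENNReal.ofReal_ne_top), mul_comm]
  exact lorentzFunctional_stieltjes_le hr hrel hq₁ hg

end Stieltjes

section Slope

variable {p₀ p₁ q : ℝ}

lemma slope_pos (hp₀ : 0 < p₀) (hq : p₀ < q) (hp₁ : 0 < p₁) : 0 < slope p₀ p₁ q :=
  div_pos (mul_pos hp₀ (hp₀.trans hq)) (mul_pos hp₁ (sub_pos.2 hq))

lemma slope_div_eq (hp₀ : 0 < p₀) (hq : p₀ < q) (hp₁ : 0 < p₁) :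
    slope p₀ p₁ q / p₀ = 1 / p₁ + slope p₀ p₁ q / q := by
  have hq_pos : 0 < q := hp₀.trans hq
  have hsub : q - p₀ ≠ 0 := (sub_pos.2 hq).ne'
  unfold slope
  field_simp
  ring

end Slope

section Decomposition

variable {α : Type*} [MeasurableSpace α] {μ : Measure α} {p q a : ℝ} {q₀ : ℝ≥0∞}

lemma rearr_le_indicator_Iic_rearr {u v : α → ℝ≥0∞} (huv : u ≤ᵐ[μ] v)
    (hu₀ : ∀ᵐ x ∂μ, v x ≤ rearr μ v a → u x = 0) (s : ℝ) :
    rearr μ u s ≤ (Set.Iic a).indicator (rearr μ v) s := by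
  by_cases hs : s ≤ a
  · rw [Set.indicator_of_mem (Set.mem_Iic.2 hs)]
    exact rearr_mono huv s
  · rw [Set.indicator_of_notMem (by simpa using hs), rearr_le_iff]
    calc μ {x | 0 < u x} ≤ μ {x | rearr μ v a < v x} := by
          refine measure_mono_ae (hu₀.mono fun x hx (hux : 0 < u x) => ?_)
          exact not_le.1 fun hle => hux.ne' (hx hle)
      _ ≤ ENNReal.ofReal a := rearr_le_iff.1 le_rfl
      _ ≤ ENNReal.ofReal s := ENNReal.ofReal_le_ofReal (not_le.1 hs).le

lemma lorentzFunctional_rearr_le_Ioc (hq₀ : q₀ ≠ 0) {u v : α → ℝ≥0∞} (huv : u ≤ᵐ[μ] v)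
    (hu₀ : ∀ᵐ x ∂μ, v x ≤ rearr μ v a → u x = 0) :
    lorentzFunctional p q₀ (Set.Ioi 0) (rearr μ u) ≤
      lorentzFunctional p q₀ (Set.Ioc 0 a) (rearr μ v) := by
  rw [← Set.Ioi_inter_Iic, Set.inter_comm, ← lorentzFunctional_indicator hq₀ measurableSet_Iic]
  exact lorentzFunctional_mono measurableSet_Ioi
    fun s _ => rearr_le_indicator_Iic_rearr huv hu₀ s

lemma lorentzFunctional_one_rearr_le (hq : 0 < q) (ha : 0 < a) {u v : α → ℝ≥0∞} {l : ℝ≥0∞}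
    (huv : u ≤ᵐ[μ] v) (hul : ∀ᵐ x ∂μ, u x ≤ l) :
    lorentzFunctional q 1 (Set.Ioi 0) (rearr μ u) ≤
      ENNReal.ofReal q * (ENNReal.ofReal (a ^ (1 / q)) * l) +
        ∫⁻ s in Set.Ioi a, ENNReal.ofReal (s ^ (1 / q - 1)) * rearr μ v s := by
  rw [lorentzFunctional_one, ← Set.Ioc_union_Ioi_eq_Ioi ha.le]
  refine (lintegral_union_le _ _ _).trans (add_le_add ?_ ?_)
  · have hrearr (s : ℝ) : rearr μ u s ≤ l := by
      rw [rearr_le_iff, show μ {x | l < u x} = 0 by simpa only [not_le] using ae_iff.1 hul]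
      exact zero_le
    calc _ ≤ ∫⁻ s in Set.Ioc 0 a, ENNReal.ofReal (s ^ (1 / q - 1)) * l := by
          gcongr with s
          exact hrearr s
      _ = ENNReal.ofReal q * (ENNReal.ofReal (a ^ (1 / q)) * l) := by
          rw [lintegral_mul_const _ (by fun_prop), setLIntegral_Ioc_rpow ha (by positivity),
            ← mul_assoc, ← ENNReal.ofReal_mul hq.le]
          congr 2
          field_simp
  · gcongr with s
    exact rearr_mono huv s

lemma exists_truncation (f : α →ₘ[μ] ℝ) (l : ℝ≥0∞) :
    ∃ f₀ f₁ : α →ₘ[μ] ℝ, f = f₀ + f₁ ∧ (∀ᵐ x ∂μ, ‖f₀ x‖ₑ ≤ ‖f x‖ₑ) ∧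
      (∀ᵐ x ∂μ, ‖f x‖ₑ ≤ l → ‖f₀ x‖ₑ = 0) ∧ (∀ᵐ x ∂μ, ‖f₁ x‖ₑ ≤ ‖f x‖ₑ) ∧
      ∀ᵐ x ∂μ, ‖f₁ x‖ₑ ≤ l := by
  have hbounded : MeasurableSet {z : ℝ | ‖z‖ₑ ≤ l} :=
    measurableSet_le measurable_enorm (by fun_prop)
  let cut : ℝ → ℝ := {z : ℝ | ‖z‖ₑ ≤ l}.indicator id
  have hcut : Measurable cut := measurable_id.indicator hbounded
  refine ⟨f - f.compMeasurable cut hcut, f.compMeasurable cut hcut, (sub_add_cancel _ _).symm, ?_⟩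
  have hf₁ := AEEqFun.coeFn_compMeasurable cut hcut f
  have hf₀ := AEEqFun.coeFn_sub f (f.compMeasurable cut hcut)
  have hcases (z : ℝ) : (‖z‖ₑ ≤ l ∧ cut z = z) ∨ (¬ ‖z‖ₑ ≤ l ∧ cut z = 0) := by
    by_cases hz : ‖z‖ₑ ≤ l
    · exact Or.inl ⟨hz, Set.indicator_of_mem (s := {z : ℝ | ‖z‖ₑ ≤ l}) hz id⟩
    · exact Or.inr ⟨hz, Set.indicator_of_notMem (s := {z : ℝ | ‖z‖ₑ ≤ l}) hz id⟩
  refine ⟨?_, ?_, ?_, ?_⟩ <;> filter_upwards [hf₀, hf₁] with x hx₀ hx₁ <;>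
    rcases hcases (f x) with ⟨hz, hcut_eq⟩ | ⟨hz, hcut_eq⟩ <;>
    simp [hx₀, hx₁, hcut_eq, hz]

lemma exists_lorentzNorm_decomposition (p : ℝ) (hq₀ : q₀ ≠ 0) (hq : 0 < q) (ha : 0 < a)
    (f : α →ₘ[μ] ℝ) :
    ∃ f₀ f₁ : α →ₘ[μ] ℝ, f = f₀ + f₁ ∧
      lorentzNorm μ p q₀ f₀ ≤ lorentzFunctional p q₀ (Set.Ioc 0 a) (rearr μ fun x => ‖f x‖ₑ) ∧
      lorentzNorm μ q 1 f₁ ≤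
        ENNReal.ofReal q * (ENNReal.ofReal (a ^ (1 / q)) * rearr μ (fun x => ‖f x‖ₑ) a) +
          ∫⁻ s in Set.Ioi a, ENNReal.ofReal (s ^ (1 / q - 1)) * rearr μ (fun x => ‖f x‖ₑ) s := by
  obtain ⟨f₀, f₁, hf, hf₀, hf₀_eq, hf₁, hf₁_le⟩ :=
    exists_truncation f (rearr μ (fun x => ‖f x‖ₑ) a)
  exact ⟨f₀, f₁, hf, lorentzFunctional_rearr_le_Ioc hq₀ hf₀ hf₀_eq,
    lorentzFunctional_one_rearr_le hq ha hf₁ hf₁_le⟩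

lemma lorentzNorm_zero (μ : Measure α) (p : ℝ) (hq₀ : q₀ ≠ 0) :
    lorentzNorm μ p q₀ (0 : α →ₘ[μ] ℝ) = 0 := by
  have hrearr (s : ℝ) : rearr μ (fun x => ‖(0 : α →ₘ[μ] ℝ) x‖ₑ) s ≤ 0 := by
    refine (rearr_mono (g := fun _ => 0) ?_ s).trans (rearr_le_iff.2 (by simp))
    filter_upwards [AEEqFun.coeFn_zero (α := α) (β := ℝ) (μ := μ)] with x hx
    simp [hx]
  refine nonpos_iff_eq_zero.1 ((lorentzFunctional_mono (h := fun _ => 0 * 0) measurableSet_Ioi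
    fun s _ => (hrearr s).trans zero_le).trans ?_)
  rw [lorentzFunctional_const_mul hq₀ _ (fun _ => 0) ENNReal.zero_ne_top, zero_mul]

lemma memSum_of_lorentzNorm_lt_top {f : α →ₘ[μ] ℝ} (hf : lorentzNorm μ p q₀ f < ∞) :
    MemSum μ p q q₀ f :=
  ⟨f, 0, (add_zero f).symm, hf, by simp [lorentzNorm_zero μ q one_ne_zero]⟩

lemma memSum_of_lorentzNorm_one_lt_top (hq₀ : q₀ ≠ 0) {f : α →ₘ[μ] ℝ}
    (hf : lorentzNorm μ q 1 f < ∞) : MemSum μ p q q₀ f :=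
  ⟨0, f, (zero_add f).symm, by simp [lorentzNorm_zero μ p hq₀], hf⟩

end Decomposition

section UpperBound

variable {α β : Type*} [MeasurableSpace α] [MeasurableSpace β] {μ : Measure α} {ν : Measure β}
  {p₀ p₁ q t : ℝ} {q₀ : ℝ≥0∞}

lemma LinearOn.quasilinearOn {D : (α →ₘ[μ] ℝ) → Prop} {T : (α →ₘ[μ] ℝ) → (β →ₘ[ν] ℝ)}
    (hT : LinearOn D T) : QuasilinearOn D T := by
  refine ⟨⟨1, fun f g hf hg => ?_⟩, fun c f hf => ?_⟩
  · rw [hT.1 f g hf hg]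
    filter_upwards [AEEqFun.coeFn_add (T f) (T g)] with y hy
    rw [hy, one_mul]
    exact abs_add_le _ _
  · rw [hT.2 c f hf]
    filter_upwards [AEEqFun.coeFn_smul c (T f)] with y hy
    rw [hy, Pi.smul_apply, smul_eq_mul, abs_mul]

lemma QuasilinearOn.exists_enorm_add_le {D : (α →ₘ[μ] ℝ) → Prop}
    {T : (α →ₘ[μ] ℝ) → (β →ₘ[ν] ℝ)} (hT : QuasilinearOn D T) :
    ∃ k : ℝ≥0, ∀ f₀ f₁, D f₀ → D f₁ →
      ∀ᵐ y ∂ν, ‖T (f₀ + f₁) y‖ₑ ≤ k * (‖T f₀ y‖ₑ + eLpNorm (T f₁) ∞ ν) := by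
  obtain ⟨⟨k, hk⟩, -⟩ := hT
  refine ⟨k.toNNReal, fun f₀ f₁ hf₀ hf₁ => ?_⟩
  filter_upwards [hk f₀ f₁ hf₀ hf₁, enorm_ae_le_eLpNormEssSup (T f₁) ν] with y hy hy₁
  rw [eLpNorm_exponent_top]
  calc ‖T (f₀ + f₁) y‖ₑ ≤ ENNReal.ofReal (k * (|T f₀ y| + |T f₁ y|)) := by
        rw [Real.enorm_eq_ofReal_abs]
        exact ENNReal.ofReal_le_ofReal hy
    _ = k.toNNReal * (‖T f₀ y‖ₑ + ‖T f₁ y‖ₑ) := by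
        rw [ENNReal.ofReal_mul' (by positivity), ENNReal.ofReal_add (abs_nonneg _) (abs_nonneg _),
          ← Real.enorm_eq_ofReal_abs, ← Real.enorm_eq_ofReal_abs]
        rfl
    _ ≤ _ := by gcongr

lemma lorentzAverage_rearr_le (hp : 0 < p₁) (hq₁ : 1 ≤ q₀) (ht : 0 < t) {u v : β → ℝ≥0∞}
    {k : ℝ≥0} {M : ℝ≥0∞} (huv : ∀ᵐ y ∂ν, u y ≤ k * (v y + M)) :
    lorentzAverage p₁ q₀ (rearr ν u) t ≤
      k * (ENNReal.ofReal (t ^ (-1 / p₁)) * lorentzFunctional p₁ q₀ (Set.Ioi 0) (rearr ν v) +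
        lorentzConst p₁ q₀ * M) := by
  calc lorentzAverage p₁ q₀ (rearr ν u) t
      ≤ lorentzAverage p₁ q₀ (fun s => k * (rearr ν v s + M)) t :=
        lorentzAverage_mono fun s _ =>
          rearr_le_mul_add huv (Eventually.of_forall fun _ => le_rfl) s
    _ = k * lorentzAverage p₁ q₀ (fun s => rearr ν v s + M) t :=
        lorentzAverage_const_mul (zero_lt_one.trans_le hq₁).ne' ENNReal.coe_ne_top
    _ ≤ k * (lorentzAverage p₁ q₀ (rearr ν v) t + lorentzConst p₁ q₀ * M) := by
        gcongr
        exact lorentzAverage_add_const_le hp hq₁ (measurable_rearr ν v) ht M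
    _ ≤ _ := by
        gcongr
        exact mul_le_mul_right (lorentzFunctional_mono_set Set.Ioc_subset_Ioi_self) _

lemma calderonR_eq (m : Measure ℝ) (hp₀ : 0 < p₀) (hq : p₀ < q) (hp₁ : 0 < p₁) (ht : 0 < t)
    (f : ℝ → ℝ≥0∞) :
    calderonR m p₀ p₁ q q₀ f t = ENNReal.ofReal ((t ^ slope p₀ p₁ q) ^ (1 / q)) *
      lorentzAverage p₀ q₀ (rearr m f) (t ^ slope p₀ p₁ q) := by
  rw [calderonR, lorentzAverage, ← mul_assoc,
    ofReal_rpow_mul_ofReal_rpow (Real.rpow_pos_of_pos ht _), ← Real.rpow_mul ht.le]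
  congr 3
  linear_combination slope_div_eq hp₀ hq hp₁

lemma lorentzConst_mul_le_calderonR (m : Measure ℝ) (hp₀ : 0 < p₀) (hq : p₀ < q) (hp₁ : 0 < p₁)
    (hq₀ : q₀ ≠ 0) (ht : 0 < t) (f : ℝ → ℝ≥0∞) :
    lorentzConst p₀ q₀ * (ENNReal.ofReal ((t ^ slope p₀ p₁ q) ^ (1 / q)) *
      rearr m f (t ^ slope p₀ p₁ q)) ≤ calderonR m p₀ p₁ q q₀ f t := by
  rw [calderonR_eq m hp₀ hq hp₁ ht, mul_left_comm]
  gcongr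
  exact lorentzConst_mul_le_lorentzAverage hp₀ hq₀ (Real.rpow_pos_of_pos ht _)
    fun s hs => rearr_antitone m f hs.2

lemma aemeasurable_calderonS (ν : Measure β) (m : Measure ℝ) (hr : 0 ≤ slope p₀ p₁ q)
    (f : ℝ → ℝ≥0∞) : AEMeasurable (calderonS m p₀ p₁ q f) (repMeasure ν) :=
  aemeasurable_restrict_of_antitoneOn (measurableSet_setOf_pos_ofReal_lt _) fun _ hs _ _ hst =>
    lintegral_mono_set (Set.Ioi_subset_Ioi (Real.rpow_le_rpow hs.1.le hst hr))

/-- The function `f` is truncated at the level `f^*(t^r)`. -/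
lemma lorentzAverage_le_calderon (hp₀ : 0 < p₀) (hq : p₀ < q) (hp₁ : 0 < p₁) (hq₁ : 1 ≤ q₀)
    {T : (α →ₘ[μ] ℝ) → (β →ₘ[ν] ℝ)} {k C₀ C₁ : ℝ≥0}
    (hk : ∀ f₀ f₁, MemSum μ p₀ q q₀ f₀ → MemSum μ p₀ q q₀ f₁ →
      ∀ᵐ y ∂ν, ‖T (f₀ + f₁) y‖ₑ ≤ k * (‖T f₀ y‖ₑ + eLpNorm (T f₁) ∞ ν))
    (hC₀ : ∀ f : α →ₘ[μ] ℝ, lorentzNorm μ p₀ q₀ f < ∞ →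
      lorentzNorm ν p₁ q₀ (T f) ≤ C₀ * lorentzNorm μ p₀ q₀ f)
    (hC₁ : ∀ f : α →ₘ[μ] ℝ, lorentzNorm μ q 1 f < ∞ →
      eLpNorm (T f) ∞ ν ≤ C₁ * lorentzNorm μ q 1 f) (f : α →ₘ[μ] ℝ) (ht : 0 < t) {R S : ℝ≥0∞}
    (hR : R = calderonR (repMeasure μ) p₀ p₁ q q₀ (rearr μ fun x => ‖f x‖ₑ) t)
    (hS : S = calderonS (repMeasure μ) p₀ p₁ q (rearr μ fun x => ‖f x‖ₑ) t)
    (hR_top : R ≠ ∞) (hS_top : S ≠ ∞) :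
    lorentzAverage p₁ q₀ (rearr ν fun y => ‖T f y‖ₑ) t ≤
      k * (C₀ * R +
        lorentzConst p₁ q₀ * (C₁ * (q.toNNReal * ((lorentzConst p₀ q₀)⁻¹ * R) + S))) := by
  have hq₀ : q₀ ≠ 0 := (zero_lt_one.trans_le hq₁).ne'
  have hκ : lorentzConst p₀ q₀ ≠ 0 := lorentzConst_ne_zero hp₀ hq₀
  set F := rearr μ fun x => ‖f x‖ₑ
  set a := t ^ slope p₀ p₁ q
  have ha : 0 < a := Real.rpow_pos_of_pos ht _
  obtain ⟨f₀, f₁, hf, hf₀, hf₁⟩ := exists_lorentzNorm_decomposition p₀ hq₀ (hp₀.trans hq) ha f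
  have hlevel : ENNReal.ofReal (a ^ (1 / q)) * F a ≤ (lorentzConst p₀ q₀)⁻¹ * R := by
    have := lorentzConst_mul_le_calderonR (repMeasure μ) hp₀ hq hp₁ hq₀ ht F
    rw [← hR, rearr_repMeasure_rearr] at this
    rwa [ENNReal.coe_inv hκ, mul_comm _ R, ← div_eq_mul_inv,
      ENNReal.le_div_iff_mul_le (by simp [hκ]) (by simp), mul_comm]
  have hf₀R : ENNReal.ofReal (t ^ (-1 / p₁)) * lorentzNorm μ p₀ q₀ f₀ ≤ R := by
    rw [hR, calderonR, rearr_repMeasure_rearr]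
    gcongr
  have hf₁S : lorentzNorm μ q 1 f₁ ≤ q.toNNReal * ((lorentzConst p₀ q₀)⁻¹ * R) + S := by
    rw [hS, calderonS, rearr_repMeasure_rearr]
    exact hf₁.trans (by gcongr; exact le_rfl)
  have hf₀_top : lorentzNorm μ p₀ q₀ f₀ < ∞ := by
    refine lt_top_iff_ne_top.2 fun h => hR_top (top_le_iff.1 (hf₀R.trans' ?_))
    rw [h, ENNReal.mul_top (ENNReal.ofReal_pos.2 (by positivity)).ne']
  have hf₁_top : lorentzNorm μ q 1 f₁ < ∞ := hf₁S.trans_lt (by finiteness)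
  have hT := hk f₀ f₁ (memSum_of_lorentzNorm_lt_top hf₀_top)
    (memSum_of_lorentzNorm_one_lt_top hq₀ hf₁_top)
  rw [← hf] at hT
  refine (lorentzAverage_rearr_le hp₁ hq₁ ht hT).trans ?_
  gcongr k * (?_ + _ * ?_)
  · calc _ ≤ ENNReal.ofReal (t ^ (-1 / p₁)) * (C₀ * lorentzNorm μ p₀ q₀ f₀) := by
          exact mul_le_mul_right (hC₀ f₀ hf₀_top) _
      _ ≤ C₀ * R := by
          rw [mul_left_comm]
          gcongr
  · exact (hC₁ f₁ hf₁_top).trans (by gcongr)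

lemma exists_lorentzAverage_le_calderon (hp₀ : 0 < p₀) (hq : p₀ < q) (hp₁ : 0 < p₁)
    (hq₁ : 1 ≤ q₀) {T : (α →ₘ[μ] ℝ) → (β →ₘ[ν] ℝ)} (hT : QuasilinearOn (MemSum μ p₀ q q₀) T)
    (hb : EndpointBounded p₀ p₁ q q₀ q₀ T) :
    ∃ C : ℝ≥0, ∀ (f : α →ₘ[μ] ℝ) (t : ℝ), 0 < t →
      lorentzAverage p₁ q₀ (rearr ν fun y => ‖T f y‖ₑ) t ≤
        C * (calderonR (repMeasure μ) p₀ p₁ q q₀ (rearr μ fun x => ‖f x‖ₑ) t +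
          calderonS (repMeasure μ) p₀ p₁ q (rearr μ fun x => ‖f x‖ₑ) t) := by
  obtain ⟨k, hk⟩ := hT.exists_enorm_add_le
  obtain ⟨⟨C₀, hC₀⟩, C₁, hC₁⟩ := hb
  let L : ℝ≥0 := lorentzConst p₁ q₀ * C₁
  let C : ℝ≥0 := k * (C₀ + L * (q.toNNReal * (lorentzConst p₀ q₀)⁻¹ + 1))
  refine ⟨C + 1, fun f t ht => ?_⟩
  set R := calderonR (repMeasure μ) p₀ p₁ q q₀ (rearr μ fun x => ‖f x‖ₑ) t with hR
  set S := calderonS (repMeasure μ) p₀ p₁ q (rearr μ fun x => ‖f x‖ₑ) t with hS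
  rcases eq_or_ne (R + S) ∞ with htop | hfin
  · rw [htop, ENNReal.mul_top (by simp)]
    exact le_top
  obtain ⟨hR_top, hS_top⟩ := ENNReal.add_ne_top.1 hfin
  calc _ ≤ _ := lorentzAverage_le_calderon hp₀ hq hp₁ hq₁ hk hC₀ hC₁ f ht hR hS hR_top hS_top
    _ ≤ k * (C₀ * (R + S) + lorentzConst p₁ q₀ *
          (C₁ * (q.toNNReal * ((lorentzConst p₀ q₀)⁻¹ * (R + S)) + (R + S)))) := by
        gcongr
        exacts [le_self_add, le_self_add, le_add_self]
    _ = C * (R + S) := by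
        simp only [C, L]
        push_cast
        ring
    _ ≤ _ := by
        gcongr
        exact le_self_add

theorem boundedToAngle_of_boundedRep [SigmaFinite ν] (hν : NonAtomic ν)
    (hp₀ : 0 < p₀) (hq : p₀ < q) (hp₁ : 0 < p₁) (hq₁ : 1 ≤ q₀)
    {X : RINorm μ} {Y : RINorm ν}
    (hR : BoundedRep X Y (calderonR (repMeasure μ) p₀ p₁ q q₀))
    (hS : BoundedRep X Y (calderonS (repMeasure μ) p₀ p₁ q))
    {T : (α →ₘ[μ] ℝ) → (β →ₘ[ν] ℝ)} (hT : QuasilinearOn (MemSum μ p₀ q q₀) T)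
    (hb : EndpointBounded p₀ p₁ q q₀ q₀ T) : BoundedToAngle X Y p₁ q₀ T := by
  obtain ⟨τ, hτ⟩ := exists_measurePreserving_repMeasure hν
  obtain ⟨C, hC⟩ := exists_lorentzAverage_le_calderon hp₀ hq hp₁ hq₁ hT hb
  obtain ⟨CR, hCR⟩ := hR
  obtain ⟨CS, hCS⟩ := hS
  have hr : 0 ≤ slope p₀ p₁ q := (slope_pos hp₀ hq hp₁).le
  refine ⟨C * (CR + CS), fun f hf => ?_⟩
  set F := rearr μ fun x => ‖f x‖ₑ
  set R := calderonR (repMeasure μ) p₀ p₁ q q₀ F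
  set S := calderonS (repMeasure μ) p₀ p₁ q F
  have hF : X.repNorm F = X.norm fun x => ‖f x‖ₑ :=
    X.repNorm_rearr f.aestronglyMeasurable.enorm
  have hFm : AEMeasurable F (repMeasure μ) := (measurable_rearr _ _).aemeasurable
  have hRm : AEMeasurable R (repMeasure ν) :=
    aemeasurable_rpow_mul_lorentzFunctional_Ioc ν (-1 / p₁) hr p₀ q₀ _
  have hSm : AEMeasurable S (repMeasure ν) := aemeasurable_calderonS ν _ hr F
  rw [← hF] at hf ⊢
  calc Y.angleNorm p₁ q₀ (T f)
      ≤ Y.repNorm fun t => C * (R t + S t) :=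
        Y.repNorm_mono hτ (aemeasurable_lorentzAverage ν p₁ q₀ _) ((hRm.add hSm).const_mul _)
          ((ae_restrict_mem (measurableSet_setOf_pos_ofReal_lt _)).mono fun t ht => hC f t ht.1)
    _ = C * Y.repNorm fun t => R t + S t := Y.repNorm_const_mul hτ C (hRm.add hSm)
    _ ≤ C * (CR * X.repNorm F + CS * X.repNorm F) := by
        gcongr
        exact (Y.repNorm_add_le hτ hRm hSm).trans (add_le_add (hCR F hFm hf) (hCS F hFm hf))
    _ = _ := by
        push_cast
        ring

end UpperBound

section StieltjesLowerBounds

variable {q a : ℝ}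

lemma rpow_le_rpow_neg_mul_rpow {c x y e : ℝ} (hc : 0 < c) (hx : 0 ≤ x) (hy : 0 < y)
    (hyx : y ≤ c * x) (he : e ≤ 0) : x ^ e ≤ c ^ (-e) * y ^ e := by
  calc x ^ e = c ^ (-e) * (c * x) ^ e := by
        rw [Real.mul_rpow hc.le hx, ← mul_assoc, ← Real.rpow_add hc, neg_add_cancel,
          Real.rpow_zero, one_mul]
    _ ≤ c ^ (-e) * y ^ e :=
        mul_le_mul_of_nonneg_left (Real.rpow_le_rpow_of_nonpos hy hyx he) (by positivity)

lemma ofReal_rpow_le_mul_rpow {c x y : ℝ} (hq : 1 ≤ q) (hc : 0 < c) (hx : 0 ≤ x) (hy : 0 < y)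
    (hyx : y ≤ c * x) :
    ENNReal.ofReal (x ^ (1 / q - 1)) ≤
      ENNReal.ofReal (c ^ (1 - 1 / q)) * ENNReal.ofReal (y ^ (1 / q - 1)) := by
  rw [← ENNReal.ofReal_mul (by positivity), ← neg_sub (1 / q)]
  exact ENNReal.ofReal_le_ofReal
    (rpow_le_rpow_neg_mul_rpow hc hx hy hyx (one_div_sub_one_nonpos hq))

lemma setLIntegral_Ioi_le_stieltjes (hq : 1 ≤ q) (g : ℝ → ℝ≥0∞) (ha : 0 < a) :
    ∫⁻ s in Set.Ioi a, ENNReal.ofReal (s ^ (1 / q - 1)) * g s ≤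
      ENNReal.ofReal (2 ^ (1 - 1 / q)) * stieltjes q g a := by
  rw [stieltjes, ← lintegral_const_mul' _ _ ENNReal.ofReal_ne_top]
  refine (setLIntegral_mono' measurableSet_Ioi fun s (has : a < s) => ?_).trans
    (lintegral_mono_set (Set.Ioi_subset_Ioi ha.le))
  rw [← mul_assoc]
  gcongr
  exact ofReal_rpow_le_mul_rpow hq two_pos (by linarith) (by linarith) (by linarith)

lemma rpow_mul_le_stieltjes (hq : 1 ≤ q) {g : ℝ → ℝ≥0∞} (ha : 0 < a) {c : ℝ≥0∞}
    (hc : ∀ s ∈ Set.Ioc 0 a, c ≤ g s) :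
    ENNReal.ofReal (a ^ (1 / q)) * c ≤ ENNReal.ofReal (2 ^ (1 - 1 / q)) * stieltjes q g a := by
  calc ENNReal.ofReal (a ^ (1 / q)) * c
      = ∫⁻ _ in Set.Ioc 0 a, ENNReal.ofReal (a ^ (1 / q - 1)) * c := by
        rw [setLIntegral_const, Real.volume_Ioc, sub_zero, mul_right_comm,
          ← ENNReal.ofReal_mul (by positivity), Real.rpow_sub_one ha.ne', div_mul_cancel₀ _ ha.ne']
    _ ≤ ∫⁻ s in Set.Ioc 0 a, ENNReal.ofReal (2 ^ (1 - 1 / q)) *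
          (ENNReal.ofReal ((s + a) ^ (1 / q - 1)) * g s) := by
        refine setLIntegral_mono' measurableSet_Ioc fun s hs => ?_
        rw [← mul_assoc]
        refine mul_le_mul' ?_ (hc s hs)
        exact ofReal_rpow_le_mul_rpow hq two_pos ha.le (by linarith [hs.1]) (by linarith [hs.2])
    _ ≤ ENNReal.ofReal (2 ^ (1 - 1 / q)) * stieltjes q g a := by
        rw [stieltjes, ← lintegral_const_mul' _ _ ENNReal.ofReal_ne_top]
        exact lintegral_mono_set Set.Ioc_subset_Ioi_self

lemma stieltjes_le_mul_stieltjes (hq : 1 ≤ q) (g : ℝ → ℝ≥0∞) {b c : ℝ} (ha : 0 ≤ a) (hb : 0 ≤ b)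
    (hc : 1 ≤ c) (hbc : b ≤ c * a) :
    stieltjes q g a ≤ ENNReal.ofReal (c ^ (1 - 1 / q)) * stieltjes q g b := by
  rw [stieltjes, stieltjes, ← lintegral_const_mul' _ _ ENNReal.ofReal_ne_top]
  refine setLIntegral_mono' measurableSet_Ioi fun s (hs : 0 < s) => ?_
  rw [← mul_assoc]
  gcongr
  exact ofReal_rpow_le_mul_rpow hq (by linarith) (by linarith) (by linarith) (by nlinarith)

lemma stieltjes_le_lorentzFunctional (hq : 1 ≤ q) (g : ℝ → ℝ≥0∞) (ha : 0 ≤ a) :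
    stieltjes q g a ≤ lorentzFunctional q 1 (Set.Ioi 0) g := by
  refine (stieltjes_antitoneOn hq g Set.self_mem_Ici ha ha).trans_eq ?_
  simp only [stieltjes, add_zero, lorentzFunctional_one]

lemma antitoneOn_stieltjes_rpow (hq : 1 ≤ q) (g : ℝ → ℝ≥0∞) {r : ℝ} (hr : 0 ≤ r) :
    AntitoneOn (fun t : ℝ => stieltjes q g (t ^ r)) (Set.Ioi 0) :=
  fun _ (hs : 0 < _) _ (ht : 0 < _) hst => stieltjes_antitoneOn hq g
    (Real.rpow_nonneg hs.le _) (Real.rpow_nonneg ht.le _) (Real.rpow_le_rpow hs.le hst hr)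

lemma aemeasurable_stieltjes_rpow {β : Type*} [MeasurableSpace β] (ν : Measure β)
    (hq : 1 ≤ q) (g : ℝ → ℝ≥0∞) {r : ℝ} (hr : 0 ≤ r) :
    AEMeasurable (fun t : ℝ => stieltjes q g (t ^ r)) (repMeasure ν) :=
  aemeasurable_restrict_of_antitoneOn (measurableSet_setOf_pos_ofReal_lt _)
    ((antitoneOn_stieltjes_rpow hq g hr).mono fun _ ht => ht.1)

lemma stieltjes_lt_top {p : ℝ} {q₀ : ℝ≥0∞} (hp : 1 < p) (hpq : p < q) (hq₁ : 1 ≤ q₀)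
    {g : ℝ → ℝ≥0∞} (hg : Measurable g) (hg_top : lorentzFunctional p q₀ (Set.Ioi 0) g < ∞)
    (ha : 0 < a) : stieltjes q g a < ∞ := by
  have hq₀ : q₀ ≠ 0 := (zero_lt_one.trans_le hq₁).ne'
  set p' := (1 / p - 1 / q)⁻¹
  have hp' : 0 < p' := inv_pos.2 (sub_pos.2 (one_div_lt_one_div_of_lt (by linarith) hpq))
  obtain ⟨C, hC⟩ := exists_lorentzFunctional_stieltjes_le (p₁ := p') hp hpq one_pos
    (by rw [one_div p', inv_inv, sub_add_cancel]) hq₁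
  simp only [Real.rpow_one] at hC
  have havg : lorentzConst p' q₀ * stieltjes q g a < ∞ := by
    calc lorentzConst p' q₀ * stieltjes q g a ≤ lorentzAverage p' q₀ (stieltjes q g) a :=
          lorentzConst_mul_le_lorentzAverage hp' hq₀ ha fun s hs =>
            stieltjes_antitoneOn (by linarith) g hs.1.le ha.le hs.2
      _ ≤ ENNReal.ofReal (a ^ (-1 / p')) * (C * lorentzFunctional p q₀ (Set.Ioi 0) g) := by
          refine mul_le_mul_right ((lorentzFunctional_mono_set Set.Ioc_subset_Ioi_self).trans ?_) _
          exact hC g hg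
      _ < ∞ := by finiteness
  refine ENNReal.lt_top_of_mul_ne_top_right havg.ne ?_
  exact ENNReal.coe_ne_zero.2 (lorentzConst_ne_zero hp' hq₀)

end StieltjesLowerBounds

section CalderonLowerBounds

variable {p₀ p₁ q t : ℝ} {q₀ : ℝ≥0∞}

lemma calderonR_le_lorentzAverage_stieltjes (m : Measure ℝ) (hp₀ : 0 < p₀) (hq : p₀ < q)
    (hq_one : 1 ≤ q) (hp₁ : 0 < p₁) (hq₀ : q₀ ≠ 0) (f : ℝ → ℝ≥0∞) (ht : 0 < t) :
    calderonR m p₀ p₁ q q₀ f t ≤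
      ENNReal.ofReal (slope p₀ p₁ q ^ (1 / q₀.toReal)) * ENNReal.ofReal (2 ^ (1 - 1 / q)) *
        lorentzAverage p₁ q₀ (fun u => stieltjes q (rearr m f) (u ^ slope p₀ p₁ q)) t := by
  set r := slope p₀ p₁ q
  set F := rearr m f
  have hr : 0 < r := slope_pos hp₀ hq hp₁
  have hrel : 1 / (p₀ / r) = 1 / p₁ + r / q := by
    rw [one_div_div]
    exact slope_div_eq hp₀ hq hp₁
  have hstieltjes : lorentzFunctional (p₀ / r) q₀ (Set.Ioc 0 t) (fun u => F (u ^ r)) ≤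
      ENNReal.ofReal (2 ^ (1 - 1 / q)) *
        lorentzFunctional p₁ q₀ (Set.Ioc 0 t) fun u => stieltjes q F (u ^ r) := by
    rw [← lorentzFunctional_rpow_mul hq₀ measurableSet_Ioc Set.Ioc_subset_Ioi_self hrel,
      ← lorentzFunctional_const_mul hq₀ _ _ ENNReal.ofReal_ne_top]
    refine lorentzFunctional_mono measurableSet_Ioc fun u hu => ?_
    rw [← mul_one_div, Real.rpow_mul hu.1.le]
    exact rpow_mul_le_stieltjes hq_one (Real.rpow_pos_of_pos hu.1 r)
      fun s hs => rearr_antitone m f hs.2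
  rw [calderonR, lorentzAverage, ← lorentzFunctional_Ioc_comp_rpow hq₀ hr ht, mul_left_comm,
    mul_assoc (ENNReal.ofReal (r ^ _)), mul_left_comm (ENNReal.ofReal (2 ^ _))]
  gcongr

lemma lorentzConst_mul_calderonS_le (m : Measure ℝ) (hq : 1 ≤ q) (hr : 0 ≤ slope p₀ p₁ q)
    (hp₁ : 0 < p₁) (hq₀ : q₀ ≠ 0) (f : ℝ → ℝ≥0∞) (ht : 0 < t) :
    lorentzConst p₁ q₀ * calderonS m p₀ p₁ q f t ≤ ENNReal.ofReal (2 ^ (1 - 1 / q)) *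
      lorentzAverage p₁ q₀ (fun u => stieltjes q (rearr m f) (u ^ slope p₀ p₁ q)) t := by
  calc lorentzConst p₁ q₀ * calderonS m p₀ p₁ q f t
      ≤ lorentzConst p₁ q₀ * (ENNReal.ofReal (2 ^ (1 - 1 / q)) *
          stieltjes q (rearr m f) (t ^ slope p₀ p₁ q)) := by
        gcongr
        exact setLIntegral_Ioi_le_stieltjes hq _ (Real.rpow_pos_of_pos ht _)
    _ ≤ _ := by
        rw [mul_left_comm]
        gcongr
        exact lorentzConst_mul_le_lorentzAverage hp₁ hq₀ ht fun u hu =>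
          antitoneOn_stieltjes_rpow hq _ hr hu.1 ht hu.2

/-- The rearrangement at `s` only sees values of the transform to the right of `s`, hence the
constant: the point `s` is compared with some `s' ∈ (s, 2s)`. -/
lemma stieltjes_le_rearr_repMeasure {β : Type*} [MeasurableSpace β] {ν : Measure β} (hq : 1 ≤ q)
    {r s : ℝ} (hr : 0 ≤ r) (g : ℝ → ℝ≥0∞) (hs : 0 < s) (hsν : ENNReal.ofReal s < ν Set.univ) :
    stieltjes q g (s ^ r) ≤ ENNReal.ofReal ((2 ^ r) ^ (1 - 1 / q)) *
      rearr (repMeasure ν) (fun t => stieltjes q g (t ^ r)) s := by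
  obtain ⟨s', hs'ν, hss', hs'⟩ : ∃ s', ENNReal.ofReal s' < ν Set.univ ∧ s' ∈ Set.Ioo s (2 * s) :=
    ((((ENNReal.continuous_ofReal.tendsto s).eventually_lt_const hsν).filter_mono
      nhdsWithin_le_nhds).and (Ioo_mem_nhdsGT (by linarith : s < 2 * s))).exists
  have hs'0 : 0 < s' := hs.trans hss'
  calc stieltjes q g (s ^ r)
      ≤ ENNReal.ofReal ((2 ^ r) ^ (1 - 1 / q)) * stieltjes q g (s' ^ r) := by
        refine stieltjes_le_mul_stieltjes hq g (by positivity) (by positivity)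
          (Real.one_le_rpow one_le_two hr) ?_
        rw [← Real.mul_rpow two_pos.le hs.le]
        exact Real.rpow_le_rpow hs'0.le hs'.le hr
    _ ≤ _ := by
        gcongr
        exact le_rearr_repMeasure_of_antitoneOn (antitoneOn_stieltjes_rpow hq g hr) hs hss' hs'ν

lemma exists_calderon_le_lorentzAverage_rearr {β : Type*} [MeasurableSpace β] (ν : Measure β)
    (hp₀ : 0 < p₀) (hq : p₀ < q) (hq_one : 1 ≤ q) (hp₁ : 0 < p₁) (hq₀ : q₀ ≠ 0) :
    ∃ C : ℝ≥0, ∀ (m : Measure ℝ) (f : ℝ → ℝ≥0∞) (t : ℝ), 0 < t → ENNReal.ofReal t < ν Set.univ →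
      calderonR m p₀ p₁ q q₀ f t + calderonS m p₀ p₁ q f t ≤
        C * lorentzAverage p₁ q₀
          (rearr (repMeasure ν) fun u => stieltjes q (rearr m f) (u ^ slope p₀ p₁ q)) t := by
  have hr : 0 < slope p₀ p₁ q := slope_pos hp₀ hq hp₁
  have hκ : lorentzConst p₁ q₀ ≠ 0 := lorentzConst_ne_zero hp₁ hq₀
  let d : ℝ≥0 := Real.toNNReal (2 ^ (1 - 1 / q))
  let c : ℝ≥0 := Real.toNNReal ((2 ^ slope p₀ p₁ q) ^ (1 - 1 / q))
  let ρ : ℝ≥0 := Real.toNNReal (slope p₀ p₁ q ^ (1 / q₀.toReal))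
  refine ⟨(ρ * d + (lorentzConst p₁ q₀)⁻¹ * d) * c, fun m f t ht htν => ?_⟩
  set H : ℝ → ℝ≥0∞ := fun u => stieltjes q (rearr m f) (u ^ slope p₀ p₁ q)
  have hR : calderonR m p₀ p₁ q q₀ f t ≤ ρ * (d * lorentzAverage p₁ q₀ H t) :=
    (calderonR_le_lorentzAverage_stieltjes m hp₀ hq hq_one hp₁ hq₀ f ht).trans_eq
      (mul_assoc _ _ _)
  have hS : calderonS m p₀ p₁ q f t ≤
      ((lorentzConst p₁ q₀)⁻¹ : ℝ≥0) * (d * lorentzAverage p₁ q₀ H t) := by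
    rw [ENNReal.coe_inv hκ, ← ENNReal.mul_le_iff_le_inv (by simpa using hκ) ENNReal.coe_ne_top]
    exact lorentzConst_mul_calderonS_le m hq_one hr.le hp₁ hq₀ f ht
  have hH : lorentzAverage p₁ q₀ H t ≤ c * lorentzAverage p₁ q₀ (rearr (repMeasure ν) H) t := by
    rw [← lorentzAverage_const_mul hq₀ ENNReal.coe_ne_top]
    exact lorentzAverage_mono fun s hs => stieltjes_le_rearr_repMeasure hq_one hr.le _ hs.1
      ((ENNReal.ofReal_le_ofReal hs.2).trans_lt htν)
  calc _ ≤ (ρ * d + (lorentzConst p₁ q₀)⁻¹ * d : ℝ≥0) * lorentzAverage p₁ q₀ H t := by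
        rw [ENNReal.coe_add, ENNReal.coe_mul, ENNReal.coe_mul, add_mul, mul_assoc, mul_assoc]
        exact add_le_add hR hS
    _ ≤ _ := by
        rw [ENNReal.coe_mul _ c, mul_assoc]
        gcongr

end CalderonLowerBounds

section StieltjesOp

variable {α β : Type*} [MeasurableSpace α] [MeasurableSpace β] {μ : Measure α} {ν : Measure β}
  [SFinite μ] {σ : α → ℝ} {θ : β → ℝ} {p q : ℝ} {q₀ : ℝ≥0∞}

lemma stronglyMeasurable_integral_add_rpow_mul (hσ : Measurable σ) (hθ : Measurable θ) (q : ℝ)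
    (g : α →ₘ[μ] ℝ) :
    StronglyMeasurable fun y => ∫ x, (σ x + θ y) ^ (1 / q - 1) * g x ∂μ := by
  have hg := g.measurable
  refine StronglyMeasurable.integral_prod_right (f := fun y x => (σ x + θ y) ^ (1 / q - 1) * g x)
    (Measurable.stronglyMeasurable ?_)
  unfold Function.uncurry
  fun_prop

/-- The linear operator with kernel `(σ(x) + θ(y))^(1/q - 1)`. With `σ` measure preserving onto
`(0, μ(α))` and `θ = τ^r` for `τ` measure preserving onto `(0, ν(β))` it attains, up to constants,
the largest values allowed by the endpoint estimates. -/
noncomputable def stieltjesOp (ν : Measure β) (hσ : Measurable σ) (hθ : Measurable θ) (q : ℝ)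
    (g : α →ₘ[μ] ℝ) : β →ₘ[ν] ℝ :=
  AEEqFun.mk (fun y => ∫ x, (σ x + θ y) ^ (1 / q - 1) * g x ∂μ)
    (stronglyMeasurable_integral_add_rpow_mul hσ hθ q g).aestronglyMeasurable

lemma coeFn_stieltjesOp (hσ : Measurable σ) (hθ : Measurable θ) (q : ℝ) (g : α →ₘ[μ] ℝ) :
    stieltjesOp ν hσ hθ q g =ᵐ[ν] fun y => ∫ x, (σ x + θ y) ^ (1 / q - 1) * g x ∂μ :=
  AEEqFun.coeFn_mk _ _

lemma lintegral_enorm_add_rpow_mul_le (hσ : MeasurePreserving σ μ (repMeasure μ))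
    (hq : 1 ≤ q) (g : α →ₘ[μ] ℝ) {a : ℝ} (ha : 0 ≤ a) :
    ∫⁻ x, ‖(σ x + a) ^ (1 / q - 1) * g x‖ₑ ∂μ ≤ stieltjes q (rearr μ fun x => ‖g x‖ₑ) a := by
  calc ∫⁻ x, ‖(σ x + a) ^ (1 / q - 1) * g x‖ₑ ∂μ
      = ∫⁻ x, ENNReal.ofReal ((σ x + a) ^ (1 / q - 1)) * ‖g x‖ₑ ∂μ := by
        refine lintegral_congr_ae ?_
        filter_upwards [ae_pos_of_measurePreserving hσ] with x hx
        rw [enorm_mul, Real.enorm_eq_ofReal (by positivity)]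
    _ ≤ stieltjes q (rearr μ fun x => ‖g x‖ₑ) a := by
        refine lintegral_comp_mul_le hσ (by fun_prop) (fun s (hs : 0 < s) t _ hst => ?_)
          g.measurable.enorm
        exact ENNReal.ofReal_le_ofReal (Real.rpow_le_rpow_of_nonpos (by positivity) (by linarith)
          (one_div_sub_one_nonpos hq))

lemma integrable_add_rpow_mul (hσ : MeasurePreserving σ μ (repMeasure μ))
    (hp : 1 < p) (hpq : p < q) (hq₁ : 1 ≤ q₀) {g : α →ₘ[μ] ℝ} (hg : MemSum μ p q q₀ g)
    {a : ℝ} (ha : 0 < a) :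
    Integrable (fun x => (σ x + a) ^ (1 / q - 1) * g x) μ := by
  have hq : 1 ≤ q := (hp.trans hpq).le
  have hσ_meas := hσ.measurable
  have hint (f : α →ₘ[μ] ℝ) (hf : stieltjes q (rearr μ fun x => ‖f x‖ₑ) a < ∞) :
      Integrable (fun x => (σ x + a) ^ (1 / q - 1) * f x) μ := by
    have hf_meas := f.measurable
    exact ⟨Measurable.aestronglyMeasurable (by fun_prop),
      (lintegral_enorm_add_rpow_mul_le hσ hq f ha.le).trans_lt hf⟩
  obtain ⟨g₀, g₁, rfl, hg₀, hg₁⟩ := hg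
  refine ((hint g₀ (stieltjes_lt_top hp hpq hq₁ (measurable_rearr _ _) hg₀ ha)).add
    (hint g₁ ((stieltjes_le_lorentzFunctional hq _ ha.le).trans_lt hg₁))).congr ?_
  filter_upwards [AEEqFun.coeFn_add g₀ g₁] with x hx
  rw [hx, Pi.add_apply, Pi.add_apply, mul_add]

lemma linearOn_stieltjesOp (hσ : MeasurePreserving σ μ (repMeasure μ))
    (hθ : Measurable θ) (hθ_pos : ∀ᵐ y ∂ν, 0 < θ y) (hp : 1 < p) (hpq : p < q) (hq₁ : 1 ≤ q₀) :
    LinearOn (MemSum μ p q q₀) (stieltjesOp ν hσ.measurable hθ q) := by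
  refine ⟨fun f g hf hg => AEEqFun.ext ?_, fun c f _ => AEEqFun.ext ?_⟩
  · filter_upwards [coeFn_stieltjesOp hσ.measurable hθ q (f + g),
      coeFn_stieltjesOp hσ.measurable hθ q f, coeFn_stieltjesOp hσ.measurable hθ q g,
      AEEqFun.coeFn_add (stieltjesOp ν hσ.measurable hθ q f) (stieltjesOp ν hσ.measurable hθ q g),
      hθ_pos] with y hTfg hTf hTg hadd hy
    rw [hTfg, hadd, Pi.add_apply, hTf, hTg,
      ← integral_add (integrable_add_rpow_mul hσ hp hpq hq₁ hf hy)
        (integrable_add_rpow_mul hσ hp hpq hq₁ hg hy)]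
    refine integral_congr_ae ?_
    filter_upwards [AEEqFun.coeFn_add f g] with x hx
    rw [hx, Pi.add_apply, mul_add]
  · filter_upwards [coeFn_stieltjesOp hσ.measurable hθ q (c • f),
      coeFn_stieltjesOp hσ.measurable hθ q f,
      AEEqFun.coeFn_smul c (stieltjesOp ν hσ.measurable hθ q f)] with y hTcf hTf hsmul
    rw [hTcf, hsmul, Pi.smul_apply, hTf, smul_eq_mul, ← integral_const_mul]
    refine integral_congr_ae ?_
    filter_upwards [AEEqFun.coeFn_smul c f] with x hx
    rw [hx, Pi.smul_apply, smul_eq_mul, mul_left_comm]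

lemma enorm_stieltjesOp_le (hσ : MeasurePreserving σ μ (repMeasure μ))
    (hθ : Measurable θ) (hθ_nonneg : ∀ᵐ y ∂ν, 0 ≤ θ y) (hq : 1 ≤ q) (g : α →ₘ[μ] ℝ) :
    ∀ᵐ y ∂ν, ‖stieltjesOp ν hσ.measurable hθ q g y‖ₑ ≤
      stieltjes q (rearr μ fun x => ‖g x‖ₑ) (θ y) := by
  filter_upwards [coeFn_stieltjesOp hσ.measurable hθ q g, hθ_nonneg] with y hTg hy
  rw [hTg]
  exact (enorm_integral_le_lintegral_enorm _).trans (lintegral_enorm_add_rpow_mul_le hσ hq g hy)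

lemma enorm_stieltjesOp_eq (hσ : MeasurePreserving σ μ (repMeasure μ))
    (hθ : Measurable θ) (hθ_pos : ∀ᵐ y ∂ν, 0 < θ y) (hp : 1 < p) (hpq : p < q) (hq₁ : 1 ≤ q₀)
    {F : ℝ → ℝ≥0∞} (hF : Measurable F)
    (hF_zero : ∀ s, μ Set.univ ≤ ENNReal.ofReal s → F s = 0) {g : α →ₘ[μ] ℝ}
    (hg : MemSum μ p q q₀ g) (hg_nonneg : 0 ≤ᵐ[μ] g)
    (hgF : ∀ᵐ x ∂μ, ENNReal.ofReal (g x) = F (σ x)) :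
    ∀ᵐ y ∂ν, ‖stieltjesOp ν hσ.measurable hθ q g y‖ₑ = stieltjes q F (θ y) := by
  filter_upwards [coeFn_stieltjesOp hσ.measurable hθ q g, hθ_pos] with y hTg hy
  have hkernel_nonneg : ∀ᵐ x ∂μ, 0 ≤ (σ x + θ y) ^ (1 / q - 1) :=
    (ae_pos_of_measurePreserving hσ).mono fun x hx => by positivity
  have hnonneg : 0 ≤ᵐ[μ] fun x => (σ x + θ y) ^ (1 / q - 1) * g x := by
    filter_upwards [hkernel_nonneg, hg_nonneg] with x hx hgx using mul_nonneg hx hgx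
  calc ‖stieltjesOp ν hσ.measurable hθ q g y‖ₑ
      = ∫⁻ x, ENNReal.ofReal ((σ x + θ y) ^ (1 / q - 1) * g x) ∂μ := by
        rw [hTg, Real.enorm_eq_ofReal (integral_nonneg_of_ae hnonneg),
          ofReal_integral_eq_lintegral_ofReal (integrable_add_rpow_mul hσ hp hpq hq₁ hg hy) hnonneg]
    _ = ∫⁻ x, ENNReal.ofReal ((σ x + θ y) ^ (1 / q - 1)) * F (σ x) ∂μ := by
        refine lintegral_congr_ae ?_
        filter_upwards [hkernel_nonneg, hgF] with x hx hgx
        rw [ENNReal.ofReal_mul hx, hgx]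
    _ = ∫⁻ s, ENNReal.ofReal ((s + θ y) ^ (1 / q - 1)) * F s ∂repMeasure μ :=
        hσ.lintegral_comp (f := fun s => ENNReal.ofReal ((s + θ y) ^ (1 / q - 1)) * F s)
          (by fun_prop)
    _ = stieltjes q F (θ y) :=
        lintegral_repMeasure_of_eq_zero fun s hs => by rw [hF_zero s hs, mul_zero]

end StieltjesOp

section Endpoints

variable {α β : Type*} [MeasurableSpace α] [MeasurableSpace β] {μ : Measure α} {ν : Measure β}
  [SFinite μ] {σ : α → ℝ} {τ : β → ℝ} {p₀ p₁ q r : ℝ} {q₀ : ℝ≥0∞}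

lemma endpointBounded_stieltjesOp (hσ : MeasurePreserving σ μ (repMeasure μ))
    (hτ : MeasurePreserving τ ν (repMeasure ν)) (hp₀ : 1 < p₀) (hq : p₀ < q) (hr : 0 < r)
    (hrel : r / p₀ = 1 / p₁ + r / q) (hq₁ : 1 ≤ q₀) :
    EndpointBounded p₀ p₁ q q₀ q₀
      (stieltjesOp (μ := μ) ν hσ.measurable (hτ.measurable.pow_const r) q) := by
  have hq_one : 1 ≤ q := (hp₀.trans hq).le
  have hτ_nonneg : ∀ᵐ y ∂ν, 0 ≤ τ y ^ r :=
    (ae_pos_of_measurePreserving hτ).mono fun y hy => by positivity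
  have hle := enorm_stieltjesOp_le hσ (hτ.measurable.pow_const r) hτ_nonneg hq_one
  constructor
  · obtain ⟨C, hC⟩ := exists_lorentzFunctional_stieltjes_le hp₀ hq hr hrel hq₁
    refine ⟨C, fun g _ => (lorentzFunctional_mono measurableSet_Ioi fun s hs => ?_).trans
      (hC _ (measurable_rearr _ _))⟩
    refine (rearr_mono (hle g) s).trans ?_
    rw [rearr_comp hτ (aemeasurable_stieltjes_rpow ν hq_one _ hr.le)]
    exact rearr_repMeasure_le_of_antitoneOn (antitoneOn_stieltjes_rpow hq_one _ hr.le) hs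
  · refine ⟨1, fun g _ => ?_⟩
    rw [ENNReal.coe_one, one_mul, eLpNorm_exponent_top]
    refine essSup_le_of_ae_le _ ?_
    filter_upwards [hle g, hτ_nonneg] with y hy hy_nonneg
    exact hy.trans (stieltjes_le_lorentzFunctional hq_one _ hy_nonneg)

end Endpoints

section LowerBound

variable {α β : Type*} [MeasurableSpace α] [MeasurableSpace β] {μ : Measure α} {ν : Measure β}
  {σ : α → ℝ} {τ : β → ℝ} {p₀ p₁ q : ℝ} {q₀ : ℝ≥0∞}

lemma RINorm.ae_lt_top [SigmaFinite μ] (X : RINorm μ) {u : α → ℝ≥0∞} (hu : AEMeasurable u μ)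
    (hXu : X.norm u < ∞) : ∀ᵐ x ∂μ, u x < ∞ := by
  rw [← Measure.restrict_univ (μ := μ), ← iUnion_spanningSets μ, ae_restrict_iUnion_iff]
  intro n
  obtain ⟨C, hC⟩ := X.lintegral_le _ (measurableSet_spanningSets μ n)
    (measure_spanningSets_lt_top μ n)
  exact ae_lt_top' hu.restrict ((hC u hu).trans_lt (by finiteness)).ne

lemma RINorm.exists_ofReal_eq_rearr_comp [SigmaFinite μ] (X : RINorm μ)
    (hσ : MeasurePreserving σ μ (repMeasure μ)) {f : ℝ → ℝ≥0∞} (hf : X.repNorm f < ∞) :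
    ∃ g : α →ₘ[μ] ℝ, 0 ≤ᵐ[μ] g ∧
      (∀ᵐ x ∂μ, ENNReal.ofReal (g x) = rearr (repMeasure μ) f (σ x)) ∧
      X.norm (fun x => ‖g x‖ₑ) = X.repNorm f := by
  set F := rearr (repMeasure μ) f
  have hFσ : Measurable fun x => F (σ x) := (measurable_rearr _ f).comp hσ.measurable
  have hrearr : rearr μ (fun x => F (σ x)) = F := by
    rw [rearr_comp hσ (measurable_rearr _ f).aemeasurable]
    simpa only [repMeasure_repMeasure] using rearr_repMeasure_rearr (μ := repMeasure μ) f
  have htop : ∀ᵐ x ∂μ, F (σ x) < ∞ := X.ae_lt_top hFσ.aemeasurable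
    (by rwa [← X.repNorm_eq_norm_of_rearr_eq hFσ.aemeasurable hrearr])
  let g : α →ₘ[μ] ℝ := AEEqFun.mk (fun x => (F (σ x)).toReal)
    hFσ.ennreal_toReal.aestronglyMeasurable
  have hg : g =ᵐ[μ] fun x => (F (σ x)).toReal := AEEqFun.coeFn_mk _ _
  have hg_nonneg : 0 ≤ᵐ[μ] g := hg.mono fun x hx => hx ▸ ENNReal.toReal_nonneg
  have hgF : ∀ᵐ x ∂μ, ENNReal.ofReal (g x) = F (σ x) := by
    filter_upwards [hg, htop] with x hx hx_top
    rw [hx, ENNReal.ofReal_toReal hx_top.ne]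
  have hgF_enorm : (fun x => ‖g x‖ₑ) =ᵐ[μ] fun x => F (σ x) := by
    filter_upwards [hg_nonneg, hgF] with x hx hxF
    rw [Real.enorm_eq_ofReal hx, hxF]
  exact ⟨g, hg_nonneg, hgF, (X.repNorm_eq_norm_of_rearr_eq g.aestronglyMeasurable.enorm
    ((rearr_congr hgF_enorm).trans hrearr)).symm⟩

lemma BoundedToAngle.boundedRep {p : ℝ} {X : RINorm μ} {Y : RINorm ν}
    (hτ : MeasurePreserving τ ν (repMeasure ν)) {T : (α →ₘ[μ] ℝ) → (β →ₘ[ν] ℝ)}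
    (hT : BoundedToAngle X Y p q₀ T) {A : (ℝ → ℝ≥0∞) → ℝ → ℝ≥0∞}
    (hA : ∀ f, AEMeasurable (A f) (repMeasure ν)) {C : ℝ≥0}
    (hAT : ∀ f, X.repNorm f < ∞ → ∃ g : α →ₘ[μ] ℝ, X.norm (fun x => ‖g x‖ₑ) = X.repNorm f ∧
      ∀ t, 0 < t → ENNReal.ofReal t < ν Set.univ →
        A f t ≤ C * lorentzAverage p q₀ (rearr ν fun y => ‖T g y‖ₑ) t) :
    BoundedRep X Y A := by
  obtain ⟨B, hB⟩ := hT
  refine ⟨C * B, fun f _ hf => ?_⟩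
  obtain ⟨g, hg, hAg⟩ := hAT f hf
  have havg := aemeasurable_lorentzAverage ν p q₀ (rearr ν fun y => ‖T g y‖ₑ)
  calc Y.repNorm (A f)
      ≤ Y.repNorm fun t => C * lorentzAverage p q₀ (rearr ν fun y => ‖T g y‖ₑ) t :=
        Y.repNorm_mono hτ (hA f) (havg.const_mul _) ((ae_restrict_mem
          (measurableSet_setOf_pos_ofReal_lt _)).mono fun t ht => hAg t ht.1 ht.2)
    _ = C * Y.angleNorm p q₀ (T g) := Y.repNorm_const_mul hτ C havg
    _ ≤ C * (B * X.norm fun x => ‖g x‖ₑ) := by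
        gcongr
        exact hB g (hg ▸ hf)
    _ = _ := by rw [hg, ENNReal.coe_mul, mul_assoc]

lemma exists_calderon_le_lorentzAverage_stieltjesOp [SigmaFinite μ]
    (hσ : MeasurePreserving σ μ (repMeasure μ)) (hτ : MeasurePreserving τ ν (repMeasure ν))
    (hp₀ : 1 < p₀) (hq : p₀ < q) (hp₁ : 0 < p₁) (hq₁ : 1 ≤ q₀) {X : RINorm μ}
    (hX : ∀ f : α →ₘ[μ] ℝ, X.norm (fun x => ‖f x‖ₑ) < ∞ → MemSum μ p₀ q q₀ f) :
    ∃ C : ℝ≥0, ∀ f, X.repNorm f < ∞ → ∃ g : α →ₘ[μ] ℝ,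
      X.norm (fun x => ‖g x‖ₑ) = X.repNorm f ∧
      ∀ t, 0 < t → ENNReal.ofReal t < ν Set.univ →
        calderonR (repMeasure μ) p₀ p₁ q q₀ f t + calderonS (repMeasure μ) p₀ p₁ q f t ≤
          C * lorentzAverage p₁ q₀ (rearr ν fun y => ‖stieltjesOp ν hσ.measurable
            (hτ.measurable.pow_const (slope p₀ p₁ q)) q g y‖ₑ) t := by
  have hp₀_pos : 0 < p₀ := zero_lt_one.trans hp₀
  have hq_one : 1 ≤ q := (hp₀.trans hq).le
  have hr : 0 < slope p₀ p₁ q := slope_pos hp₀_pos hq hp₁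
  have hτ_pos : ∀ᵐ y ∂ν, 0 < τ y ^ slope p₀ p₁ q :=
    (ae_pos_of_measurePreserving hτ).mono fun y hy => Real.rpow_pos_of_pos hy _
  obtain ⟨C, hC⟩ := exists_calderon_le_lorentzAverage_rearr ν hp₀_pos hq hq_one hp₁
    (zero_lt_one.trans_le hq₁).ne'
  refine ⟨C, fun f hf => ?_⟩
  obtain ⟨g, hg_nonneg, hgF, hg⟩ := X.exists_ofReal_eq_rearr_comp hσ hf
  have hTg := enorm_stieltjesOp_eq hσ (hτ.measurable.pow_const (slope p₀ p₁ q)) hτ_pos hp₀ hq hq₁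
    (measurable_rearr _ f) (fun s hs => rearr_eq_zero f (by rwa [repMeasure_univ]))
    (hX g (hg ▸ hf)) hg_nonneg hgF
  refine ⟨g, hg, fun t ht htν => ?_⟩
  rw [rearr_congr hTg, rearr_comp hτ (aemeasurable_stieltjes_rpow ν hq_one _ hr.le)]
  exact hC _ f t ht htν

theorem boundedRep_of_forall_boundedToAngle [SigmaFinite μ] [SigmaFinite ν] (hμ : NonAtomic μ)
    (hν : NonAtomic ν) (hp₀ : 1 < p₀) (hq : p₀ < q) (hp₁ : 0 < p₁) (hq₁ : 1 ≤ q₀)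
    {X : RINorm μ} {Y : RINorm ν}
    (hX : ∀ f : α →ₘ[μ] ℝ, X.norm (fun x => ‖f x‖ₑ) < ∞ → MemSum μ p₀ q q₀ f)
    (hlin : ∀ T : (α →ₘ[μ] ℝ) → (β →ₘ[ν] ℝ), LinearOn (MemSum μ p₀ q q₀) T →
      EndpointBounded p₀ p₁ q q₀ q₀ T → BoundedToAngle X Y p₁ q₀ T) :
    BoundedRep X Y (calderonR (repMeasure μ) p₀ p₁ q q₀) ∧
      BoundedRep X Y (calderonS (repMeasure μ) p₀ p₁ q) := by
  obtain ⟨σ, hσ⟩ := exists_measurePreserving_repMeasure hμ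
  obtain ⟨τ, hτ⟩ := exists_measurePreserving_repMeasure hν
  have hp₀_pos : 0 < p₀ := zero_lt_one.trans hp₀
  have hr : 0 < slope p₀ p₁ q := slope_pos hp₀_pos hq hp₁
  have hτ_pos : ∀ᵐ y ∂ν, 0 < τ y ^ slope p₀ p₁ q :=
    (ae_pos_of_measurePreserving hτ).mono fun y hy => Real.rpow_pos_of_pos hy _
  have hT := hlin _
    (linearOn_stieltjesOp hσ (hτ.measurable.pow_const _) hτ_pos hp₀ hq hq₁)
    (endpointBounded_stieltjesOp hσ hτ hp₀ hq hr (slope_div_eq hp₀_pos hq hp₁) hq₁)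
  obtain ⟨C, hC⟩ := exists_calderon_le_lorentzAverage_stieltjesOp hσ hτ hp₀ hq hp₁ hq₁ hX
  refine ⟨hT.boundedRep hτ (C := C)
      (fun f => aemeasurable_rpow_mul_lorentzFunctional_Ioc ν (-1 / p₁) hr.le p₀ q₀ _)
      fun f hf => ?_,
    hT.boundedRep hτ (C := C) (fun f => aemeasurable_calderonS ν _ hr.le f) fun f hf => ?_⟩
  all_goals obtain ⟨g, hg, hle⟩ := hC f hf
  · exact ⟨g, hg, fun t ht htν => le_self_add.trans (hle t ht htν)⟩
  · exact ⟨g, hg, fun t ht htν => le_add_self.trans (hle t ht htν)⟩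

end LowerBound

end CalderonLorentz

theorem mainTheorem1_general {α β : Type*} [MeasurableSpace α] [MeasurableSpace β]
    (μ : Measure α) (ν : Measure β) [SigmaFinite μ] [SigmaFinite ν]
    (hμ : CalderonLorentz.NonAtomic μ) (hν : CalderonLorentz.NonAtomic ν)
    (p₀ p₁ q : ℝ) (q₀ : ℝ≥0∞) (hp₀ : 1 < p₀) (hq : p₀ < q) (hp₁ : 0 < p₁) (hq₀ : 1 ≤ q₀)
    (X : CalderonLorentz.RINorm μ) (Y : CalderonLorentz.RINorm ν)
    (hX : ∀ f : α →ₘ[μ] ℝ, X.norm (fun x => ‖f x‖ₑ) < ∞ →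
      CalderonLorentz.MemSum μ p₀ q q₀ f) :
    List.TFAE [
      ∀ T : (α →ₘ[μ] ℝ) → (β →ₘ[ν] ℝ),
        CalderonLorentz.LinearOn (CalderonLorentz.MemSum μ p₀ q q₀) T →
        CalderonLorentz.EndpointBounded p₀ p₁ q q₀ q₀ T →
        CalderonLorentz.BoundedToAngle X Y p₁ q₀ T,
      ∀ T : (α →ₘ[μ] ℝ) → (β →ₘ[ν] ℝ),
        CalderonLorentz.QuasilinearOn (CalderonLorentz.MemSum μ p₀ q q₀) T →
        CalderonLorentz.EndpointBounded p₀ p₁ q q₀ q₀ T →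
        CalderonLorentz.BoundedToAngle X Y p₁ q₀ T,
      CalderonLorentz.BoundedRep X Y
          (CalderonLorentz.calderonR (CalderonLorentz.repMeasure μ) p₀ p₁ q q₀) ∧
        CalderonLorentz.BoundedRep X Y
          (CalderonLorentz.calderonS (CalderonLorentz.repMeasure μ) p₀ p₁ q)] := by
  tfae_have 2 → 1 := fun h T hT hb => h T hT.quasilinearOn hb
  tfae_have 3 → 2 := fun h T hT hb =>
    CalderonLorentz.boundedToAngle_of_boundedRep hν (zero_lt_one.trans hp₀) hq hp₁ hq₀ h.1 h.2
      hT hb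
  tfae_have 1 → 3 := fun h =>
    CalderonLorentz.boundedRep_of_forall_boundedToAngle hμ hν hp₀ hq hp₁ hq₀ hX h
  tfae_finish

theorem mainTheorem1 {α β : Type*} [MeasurableSpace α] [MeasurableSpace β]
    (μ : Measure α) (ν : Measure β) [SigmaFinite μ] [SigmaFinite ν]
    (hμ : CalderonLorentz.NonAtomic μ) (hν : CalderonLorentz.NonAtomic ν)
    (p₀ p₁ q : ℝ) (q₀ : ℝ≥0∞) (hp₀ : 1 < p₀) (hq : p₀ < q) (hp₁ : 1 < p₁) (hq₀ : 1 ≤ q₀)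
    (X : CalderonLorentz.RINorm μ) (Y : CalderonLorentz.RINorm ν)
    (hX : ∀ f : α →ₘ[μ] ℝ, X.norm (fun x => ‖f x‖ₑ) < ∞ →
      CalderonLorentz.MemSum μ p₀ q q₀ f) :
    List.TFAE [
      ∀ T : (α →ₘ[μ] ℝ) → (β →ₘ[ν] ℝ),
        CalderonLorentz.LinearOn (CalderonLorentz.MemSum μ p₀ q q₀) T →
        CalderonLorentz.EndpointBounded p₀ p₁ q q₀ q₀ T →
        CalderonLorentz.BoundedToAngle X Y p₁ q₀ T,
      ∀ T : (α →ₘ[μ] ℝ) → (β →ₘ[ν] ℝ),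
        CalderonLorentz.QuasilinearOn (CalderonLorentz.MemSum μ p₀ q q₀) T →
        CalderonLorentz.EndpointBounded p₀ p₁ q q₀ q₀ T →
        CalderonLorentz.BoundedToAngle X Y p₁ q₀ T,
      CalderonLorentz.BoundedRep X Y
          (CalderonLorentz.calderonR (CalderonLorentz.repMeasure μ) p₀ p₁ q q₀) ∧
        CalderonLorentz.BoundedRep X Y
          (CalderonLorentz.calderonS (CalderonLorentz.repMeasure μ) p₀ p₁ q)] :=
  mainTheorem1_general μ ν hμ hν p₀ p₁ q q₀ hp₀ hq (zero_lt_one.trans hp₁) hq₀ X Y hX
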